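/- Let $d\ge 1$, let $\mathbb H$ be a separable complex Hilbert space with inner product $\langle\cdot,\cdot\rangle$ and a designated ("real") complete orthonormal system $\{e_j\}$, put $\overline{x}=\sum_j\overline{\langle x,e_j\rangle}\,e_j$ (so $x$ is real if $\overline x=x$), $(x\otimes y)(z)=\langle z,y\rangle x$, and write $\|\cdot\|_{\rm tr}$, $\|\cdot\|_{\rm HS}$, $\langle\cdot,\cdot\rangle_{\rm HS}$ for the trace norm, Hilbert–Schmidt norm and Hilbert–Schmidt inner product of operators on $\mathbb H$. **Process.** Call a process $X=\{X(t),t\in\mathbb Z^d\}$ with values in $\mathbb H$ *admissible* if it is real, has mean zero, is second-order stationary (finite second moments; $\mathbb E[X(t)\otimes X(s)]$ and $\mathbb E[X(t)\otimes\overline{X(s)}]$ depend on $t-s$ only), its covariance $C(h)=\mathbb E[X(h)\otimes X(0)]$ satisfies $\sum_{k}\|C(k)\|_{\rm tr}<\infty$, $\mathbb E\|X(t)\|^4<\infty$ for all $t$, and the fourth-order cumulants $$\begin{aligned}{\rm cum}(Y_1,Y_2,Y_3,Y_4)={}&\mathbb E\langle Y_1\otimes Y_2,Y_3\otimes Y_4\rangle_{\rm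 HS}-\langle\mathbb E(Y_1\otimes Y_2),\mathbb E(Y_3\otimes Y_4)\rangle_{\rm HS}\\&-\mathbb E\langle Y_1,Y_3\rangle\,\mathbb E\langle Y_4,Y_2\rangle-\langle\mathbb E(Y_1\otimes\overline{Y_4}),\mathbb E(Y_3\otimes\overline{Y_2})\rangle_{\rm HS}\end{aligned}$$ are shift invariant, ${\rm cum}(X(t+\tau),X(s+\tau),X(w+\tau),X(v+\tau))={\rm cum}(X(t),X(s),X(w),X(v))$, with $$\kappa(X):=\sup_{w\in\mathbb Z^d}\sum_{u\in\mathbb Z^d}\sum_{v\in\mathbb Z^d}|{\rm cum}(X(u),X(v),X(w),X(0))|<\infty .$$ Its spectral density is $f(\theta)=(2\pi)^{-d}\sum_{k\in\mathbb Z^d}e^{\mathbf i k^\top\theta}C(k)$. For $\beta,L>0$ let $$\mathcal P_D(\beta,L)=\Big\{f(\theta)=(2\pi)^{-d}\sum_{k\in\mathbb Z^d}C(k)e^{\mathbf i\theta^\top k}:\ \sum_{k\in\mathbb Z^d}\|C(k)\|_{\rm tr}(1+\|k\|_2^\beta)\le L\Big\}.$$ **Kernel.** Let $K:\mathbb R^d\to[0,\infty)$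 be continuous, with $S_K=\{K>0\}$ bounded, $\sup K=K(0)=1$, and differentiable with bounded gradient in a neighbourhood of $0$. Suppose that for some integer $\lambda>\max(0,\beta-1)$ all partial derivatives of $K$ up to order $\lambda+1$ exist on $\mathbb R^d$, $\partial^{\alpha}K(0)=0$ for $1\le|\alpha|\le\lambda$, and $\sup_h|\partial^\alpha K(h)|<\infty$ for $|\alpha|=\lambda+1$. **Sampling and estimator.** Let $\mathbb T_n=\prod_{\ell=1}^d\{1,\dots,n_\ell\}$ with $n_\ell\to\infty$ for every $\ell$ as $n\to\infty$, let $|\mathbb T_n|=\prod_\ell n_\ell$ be its cardinality, $T_n=\prod_\ell[0,n_\ell]$, and let $\Delta_n>0$ be such that $(\Delta_nS_K)\cap\mathbb Z^d\subset\mathbb T_n-\mathbb T_n$ for all $n$ and $\Delta_n^d/|\mathbb T_n|\to0$. With $|\cdot|$ in the denominator denoting Lebesgue measure, let $$\hat f_n(\theta)=\frac1{(2\pi)^d}\sum_{t\in\mathbb T_n}\sum_{s\in\mathbb T_n}e^{\mathbf i(t-s)^\top\theta}\,\frac{X(t)\otimes X(s)}{|T_n\cap(T_n-(t-s))|}\,K\Big(\frac{t-s}{\Delta_n}\Big).$$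 **Claim.** (i) Uniformly over all admissible processes $X$ (on any probability space) whose spectral density $f$ lies in $\mathcal P_D(\beta,L)$, $$\sup_{f\in\mathcal P_D(\beta,L)}\ \sup_{\theta\in[-\pi,\pi]^d}\big\|\mathbb E\hat f_n(\theta)-f(\theta)\big\|_{\rm HS}=\mathcal O(\Delta_n^{-\beta}),\qquad n\to\infty .$$ (ii) If moreover $\Delta_n=|\mathbb T_n|^{1/(2\beta+d)}$ for all $n$, then for every $M<\infty$, uniformly over all admissible processes $X$ (on any probability space) with $\kappa(X)\le M$ whose spectral density $f$ lies in $\mathcal P_D(\beta,L)$, $$\sup_{f\in\mathcal P_D(\beta,L)}\ \sup_{\theta\in[-\pi,\pi]^d}\Big(\mathbb E\big\|\hat f_n(\theta)-f(\theta)\big\|_{\rm HS}^2\Big)^{1/2}=\mathcal O\big(|\mathbb T_n|^{-\beta/(2\beta+d)}\big),\qquad n\to\infty .$$ -/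

import Mathlib

open MeasureTheory Filter Topology
open scoped ENNReal NNReal Pointwise

noncomputable section

namespace SpectralDensity

/-! ### Operators on a Hilbert space -/

section Operators

variable {H : Type*} [NormedAddCommGroup H] [InnerProductSpace ℂ H] [CompleteSpace H]
variable {ι : Type*}

/-- The trace norm `‖T‖_tr = ∑ j, ⟨(T* T)^{1/2} e_j, e_j⟩ ∈ [0, ∞]`. -/
def traceNorm (e : HilbertBasis ι ℂ H) (T : H →L[ℂ] H) : ℝ≥0∞ :=
  ∑' j, ENNReal.ofReal (RCLike.re (inner ℂ (CFC.abs T (e j)) (e j)))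

/-- The Hilbert-Schmidt norm `‖T‖_HS = (∑ j, ‖T e_j‖²)^{1/2} = (trace (T* T))^{1/2} ∈ [0, ∞]`. -/
def hsNorm (e : HilbertBasis ι ℂ H) (T : H →L[ℂ] H) : ℝ≥0∞ :=
  (∑' j, ‖T (e j)‖ₑ ^ 2) ^ (1 / 2 : ℝ)

/-- The Hilbert-Schmidt inner product `⟨A, B⟩_HS = trace (A* B) = ∑ j, ⟨A e_j, B e_j⟩`
(inner products are conjugate-linear in the first variable). -/
def hsInner (e : HilbertBasis ι ℂ H) (A B : H →L[ℂ] H) : ℂ :=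
  ∑' j, inner ℂ (A (e j)) (B (e j))

/-- Complex conjugation with respect to the designated real orthonormal basis. -/
def conjVec (e : HilbertBasis ι ℂ H) (x : H) : H :=
  ∑' j, (starRingEnd ℂ) (inner ℂ (e j) x) • e j

end Operators

/-! ### Second-order structure of a random field -/

section RandomField

variable {H : Type*} [NormedAddCommGroup H] [InnerProductSpace ℂ H] [CompleteSpace H]
variable {ι : Type*} {Ω : Type*} [MeasurableSpace Ω] {d : ℕ}

/-- The cross-covariance operator `E[Y ⊗ Z]` of centred random vectors, where
`(y ⊗ z)(x) = ⟨x, z⟩ y`. -/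
def covOp (P : Measure Ω) (Y Z : Ω → H) : H →L[ℂ] H :=
  ∫ ω, InnerProductSpace.rankOne ℂ (Y ω) (Z ω) ∂P

/-- The fourth-order cumulant of centred random vectors in `H`. -/
def cum4 (e : HilbertBasis ι ℂ H) (P : Measure Ω) (Y₁ Y₂ Y₃ Y₄ : Ω → H) : ℂ :=
  (∫ ω, hsInner e (InnerProductSpace.rankOne ℂ (Y₁ ω) (Y₂ ω))
      (InnerProductSpace.rankOne ℂ (Y₃ ω) (Y₄ ω)) ∂P)
    - hsInner e (covOp P Y₁ Y₂) (covOp P Y₃ Y₄)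
    - (∫ ω, inner ℂ (Y₁ ω) (Y₃ ω) ∂P) * (∫ ω, inner ℂ (Y₄ ω) (Y₂ ω) ∂P)
    - hsInner e (covOp P Y₁ (fun ω => conjVec e (Y₄ ω)))
        (covOp P Y₃ (fun ω => conjVec e (Y₂ ω)))

/-- `X` is a centred second-order stationary random field on `ℤ^d`: square integrable, of mean
zero, with covariance and pseudo-covariance operators depending on the lag only. -/
structure IsSecondOrderStationary (e : HilbertBasis ι ℂ H) (P : Measure Ω)
    (X : (Fin d → ℤ) → Ω → H) : Prop where
  memLp_two : ∀ t, MemLp (X t) 2 P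
  mean_zero : ∀ t, ∫ ω, X t ω ∂P = 0
  cov_shift : ∀ t s τ, covOp P (X (t + τ)) (X (s + τ)) = covOp P (X t) (X s)
  pseudoCov_shift : ∀ t s τ,
    covOp P (X (t + τ)) (fun ω => conjVec e (X (s + τ) ω))
      = covOp P (X t) (fun ω => conjVec e (X s ω))

/-- `X` takes values in the real part of `H` (with respect to the basis `e`). -/
def IsRealField (e : HilbertBasis ι ℂ H) (P : Measure Ω) (X : (Fin d → ℤ) → Ω → H) : Prop :=
  ∀ t, ∀ᵐ ω ∂P, conjVec e (X t ω) = X t ω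

/-- The stationary covariance operator `C(h) = E[X(h) ⊗ X(0)]`. -/
def autoCov (P : Measure Ω) (X : (Fin d → ℤ) → Ω → H) (h : Fin d → ℤ) : H →L[ℂ] H :=
  covOp P (X h) (X 0)

/-- `sup_w ∑_u ∑_v |cum(X(u), X(v), X(w), X(0))| ∈ [0, ∞]`. -/
def cumulantSum (e : HilbertBasis ι ℂ H) (P : Measure Ω) (X : (Fin d → ℤ) → Ω → H) : ℝ≥0∞ :=
  ⨆ w : Fin d → ℤ, ∑' u : Fin d → ℤ, ∑' v : Fin d → ℤ, ‖cum4 e P (X u) (X v) (X w) (X 0)‖ₑ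

/-- The standing conditions on the observed random field on `ℤ^d`. -/
structure IsRegularField (e : HilbertBasis ι ℂ H) (P : Measure Ω)
    (X : (Fin d → ℤ) → Ω → H) : Prop where
  stationary : IsSecondOrderStationary e P X
  real : IsRealField e P X
  summable_cov : ∑' k, traceNorm e (autoCov P X k) < ∞
  memLp_four : ∀ t, MemLp (X t) 4 P
  cum_shift : ∀ t s w v τ,
    cum4 e P (X (t + τ)) (X (s + τ)) (X (w + τ)) (X (v + τ)) = cum4 e P (X t) (X s) (X w) (X v)
  cum_summable : cumulantSum e P X < ∞

end RandomField

/-! ### Spectral densities and the power-law class -/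

section Spectral

variable {H : Type*} [NormedAddCommGroup H] [InnerProductSpace ℂ H] [CompleteSpace H]
variable {ι : Type*} {d : ℕ}

/-- A lattice point as a point of Euclidean space. -/
def latticePt (k : Fin d → ℤ) : EuclideanSpace ℝ (Fin d) :=
  WithLp.toLp 2 (fun i => (k i : ℝ))

/-- The character `e^{i kᵀθ}`. -/
def character (k : Fin d → ℤ) (θ : Fin d → ℝ) : ℂ :=
  Complex.exp (Complex.I * ((∑ i, (k i : ℝ) * θ i : ℝ) : ℂ))

/-- The operator-valued Fourier series `θ ↦ (2π)^{-d} ∑_k e^{i kᵀθ} C(k)`. -/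
def fourierSeries (C : (Fin d → ℤ) → H →L[ℂ] H) (θ : Fin d → ℝ) : H →L[ℂ] H :=
  (((2 * Real.pi) ^ d : ℝ) : ℂ)⁻¹ • ∑' k, character k θ • C k

/-- The spectral density of a second-order stationary random field on `ℤ^d`. -/
def spectralDensity {Ω : Type*} [MeasurableSpace Ω] (P : Measure Ω)
    (X : (Fin d → ℤ) → Ω → H) : (Fin d → ℝ) → H →L[ℂ] H :=
  fourierSeries (autoCov P X)

/-- The power-law decay class `𝒫_D(β, L)`. -/
def powerLawClass (e : HilbertBasis ι ℂ H) (d : ℕ) (β L : ℝ) :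
    Set ((Fin d → ℝ) → H →L[ℂ] H) :=
  {f | ∃ C : (Fin d → ℤ) → H →L[ℂ] H, f = fourierSeries C ∧
    ∑' k, traceNorm e (C k) * ENNReal.ofReal (1 + ‖latticePt k‖ ^ β) ≤ ENNReal.ofReal L}

end Spectral

/-! ### Kernels -/

section Kernel

variable {d : ℕ}

/-- The set `S_K = {t | K t > 0}`. -/
def kernelSupport (K : EuclideanSpace ℝ (Fin d) → ℝ) : Set (EuclideanSpace ℝ (Fin d)) :=
  {t | 0 < K t}

/-- The standard conditions on the kernel. -/
structure IsKernel (K : EuclideanSpace ℝ (Fin d) → ℝ) : Prop where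
  continuous : Continuous K
  nonneg : ∀ u, 0 ≤ K u
  bounded_support : Bornology.IsBounded (kernelSupport K)
  map_zero : K 0 = 1
  le_one : ∀ u, K u ≤ 1
  gradient_bounded : ∃ ε > 0, (∀ u ∈ Metric.ball 0 ε, DifferentiableAt ℝ K u) ∧
    ∃ B : ℝ, ∀ u ∈ Metric.ball 0 ε, ‖gradient K u‖ ≤ B

/-- The iterated partial derivative of `K` in the coordinate directions listed in `a`. A list in
which the index `i` occurs `α i` times gives the derivative `∂^α`, whose order `|α|` is the length
of the list. -/
def iterPartial (K : EuclideanSpace ℝ (Fin d) → ℝ) :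
    List (Fin d) → EuclideanSpace ℝ (Fin d) → ℝ
  | [] => K
  | i :: a => fun x => lineDeriv ℝ (iterPartial K a) x (EuclideanSpace.single i 1)

/-- `K` is flat to order `r` at the origin: all partial derivatives up to order `r + 1` exist
everywhere, those of orders `1, …, r` vanish at `0` and those of order `r + 1` are bounded. -/
structure IsFlatToOrder (K : EuclideanSpace ℝ (Fin d) → ℝ) (r : ℕ) : Prop where
  exists_partial : ∀ a : List (Fin d), a.length ≤ r → ∀ (i : Fin d) (x : EuclideanSpace ℝ (Fin d)),
    LineDifferentiableAt ℝ (iterPartial K a) x (EuclideanSpace.single i 1)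
  partial_zero : ∀ a : List (Fin d), 1 ≤ a.length → a.length ≤ r → iterPartial K a 0 = 0
  partial_bounded : ∀ a : List (Fin d), a.length = r + 1 → ∃ B : ℝ, ∀ x, |iterPartial K a x| ≤ B

end Kernel

/-! ### The estimator -/

section Estimator

variable {H : Type*} [NormedAddCommGroup H] [InnerProductSpace ℂ H] [CompleteSpace H]
variable {Ω : Type*} {d : ℕ}

/-- The sampling grid `{1, …, N_1} × ⋯ × {1, …, N_d}`. -/
def grid (N : Fin d → ℕ) : Finset (Fin d → ℤ) :=
  Finset.Icc 1 (fun i => (N i : ℤ))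

/-- The sampling region `[0, N_1] × ⋯ × [0, N_d]`. -/
def region (N : Fin d → ℕ) : Set (Fin d → ℝ) :=
  Set.Icc 0 (fun i => (N i : ℝ))

/-- The Lebesgue measure `|T ∩ (T - h)|`, where `T` is the sampling region. -/
def overlap (N : Fin d → ℕ) (h : Fin d → ℤ) : ℝ :=
  (volume (region N ∩ {x | x + (fun i => (h i : ℝ)) ∈ region N})).toReal

/-- The lag-window estimator of the spectral density with kernel `K` and bandwidth `Δ`. -/
def estimator (K : EuclideanSpace ℝ (Fin d) → ℝ) (N : Fin d → ℕ) (Δ : ℝ)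
    (X : (Fin d → ℤ) → Ω → H) (θ : Fin d → ℝ) (ω : Ω) : H →L[ℂ] H :=
  (((2 * Real.pi) ^ d : ℝ) : ℂ)⁻¹ • ∑ t ∈ grid N, ∑ s ∈ grid N,
    (character (t - s) θ * ((K (Δ⁻¹ • latticePt (t - s)) / overlap N (t - s) : ℝ) : ℂ)) •
      InnerProductSpace.rankOne ℂ (X t ω) (X s ω)

end Estimator

end SpectralDensity

end

open SpectralDensity

set_option linter.unusedSectionVars false

noncomputable section

namespace SpectralDensity

section OperatorLemmas

variable {H : Type*} [NormedAddCommGroup H] [InnerProductSpace ℂ H] [CompleteSpace H]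
variable {ι : Type*}

/-! ### Hilbert-Schmidt and trace norms -/

/-! The Hilbert–Schmidt operators are realised as families `j ↦ T (e j)` in the Hilbert space `lp
(fun _ => H) 2`, where the error splits into a bias and a centred random sum.

Bias. For an integer lag `h` of the grid, the number of pairs `(t, s)` with `t - s = h` is exactly
the Lebesgue measure `overlap N h`, since both equal `∏ (N l - |h l|)`. The normalisation therefore
cancels, and the mean of the estimator is the Fourier series of `K(h/Δ) C(h)`. Flatness at the
origin gives `|K u - 1| ≤ c ‖u‖ ^ β`, so the bias is at most `c Δ ^ (-β) ∑ ‖C(k)‖_tr ‖k‖ ^ β ≤ c L Δ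
^ (-β)` (`norm_lag_series_sub_le`). Membership in the class only provides some coefficient family;
uniqueness of Fourier coefficients identifies it with the autocovariance.

Variance. The covariance of `X(t) ⊗ X(s)` and `X(t') ⊗ X(s')` is a fourth-order cumulant plus two
products of second-order terms, each bounded by trace norms of `C`. Its absolute row sums are at
most `M + 2 L ^ 2`, so by Schur's test the variance is at most this constant times the sum of the
squared weights, itself at most `∑ K(h/Δ) ^ 2 / overlap N h`.

The delicate point is that this sum is `O(Δ ^ d / |T|)`, because `overlap N h` degenerates when lags
reach the edge of the grid (`exists_sum_sq_div_overlap_le`). The support condition forces `K` to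
vanish at the first lag beyond the edge. As `K` has bounded partial derivatives, it decays linearly
towards the edge in every coordinate, and a geometric mean over the coordinates makes the sum
factorise into convergent one-dimensional sums. -/

theorem tsum_enorm_inner_sq (e : HilbertBasis ι ℂ H) (x : H) :
    ∑' j, ‖inner ℂ (e j) x‖ₑ ^ 2 = ‖x‖ₑ ^ 2 := by
  have h := lp.hasSum_norm (p := 2) (by norm_num) (e.repr x)
  simp only [e.repr.norm_map, e.repr_apply_apply, ENNReal.toReal_ofNat, Real.rpow_ofNat] at h
  have h2 := ENNReal.ofReal_tsum_of_nonneg (fun j => by positivity) h.summable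
  rw [h.tsum_eq] at h2
  simp only [ENNReal.ofReal_pow (norm_nonneg _), ofReal_norm] at h2
  exact h2.symm

theorem tsum_enorm_adjoint_sq (e : HilbertBasis ι ℂ H) (A : H →L[ℂ] H) :
    ∑' j, ‖(ContinuousLinearMap.adjoint A) (e j)‖ₑ ^ 2 = ∑' j, ‖A (e j)‖ₑ ^ 2 := by
  simp_rw [← tsum_enorm_inner_sq e (A _),
    ← tsum_enorm_inner_sq e (ContinuousLinearMap.adjoint A _)]
  rw [ENNReal.tsum_comm]
  refine tsum_congr fun i => tsum_congr fun j => ?_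
  rw [ContinuousLinearMap.adjoint_inner_right, ← inner_conj_symm, RCLike.enorm_conj]

theorem tsum_enorm_mul_left_sq_le (e : HilbertBasis ι ℂ H) (A B : H →L[ℂ] H) :
    ∑' j, ‖(B * A) (e j)‖ₑ ^ 2 ≤ ‖B‖ₑ ^ 2 * ∑' j, ‖A (e j)‖ₑ ^ 2 := by
  rw [← ENNReal.tsum_mul_left]
  refine ENNReal.tsum_le_tsum fun j => ?_
  rw [← mul_pow]
  gcongr
  exact B.le_opENorm _

theorem tsum_enorm_mul_right_sq_le (e : HilbertBasis ι ℂ H) (A B : H →L[ℂ] H) :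
    ∑' j, ‖(A * B) (e j)‖ₑ ^ 2 ≤ ‖B‖ₑ ^ 2 * ∑' j, ‖A (e j)‖ₑ ^ 2 := by
  rw [← tsum_enorm_adjoint_sq, ← tsum_enorm_adjoint_sq e A]
  have := tsum_enorm_mul_left_sq_le e (ContinuousLinearMap.adjoint A)
    (ContinuousLinearMap.adjoint B)
  have h2 : ‖ContinuousLinearMap.adjoint B‖ₑ = ‖B‖ₑ := by
    rw [← ofReal_norm, ← ofReal_norm, LinearIsometryEquiv.norm_map]
  rw [h2] at this
  convert this using 4
  simp [← ContinuousLinearMap.star_eq_adjoint]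

/-- Passing to the adjoint turns each coefficient of `A x` into `⟨A* e_j, x⟩`, to which
Cauchy–Schwarz applies termwise. -/
theorem enorm_sq_le_tsum (e : HilbertBasis ι ℂ H) (A : H →L[ℂ] H) :
    ‖A‖ₑ ^ 2 ≤ ∑' j, ‖A (e j)‖ₑ ^ 2 := by
  rw [← tsum_enorm_adjoint_sq]
  set h := ∑' j, ‖(ContinuousLinearMap.adjoint A) (e j)‖ₑ ^ 2 with hh
  have key : ∀ x, ‖A x‖ₑ ^ 2 ≤ h * ‖x‖ₑ ^ 2 := by
    intro x
    rw [← tsum_enorm_inner_sq e (A x), hh, ← ENNReal.tsum_mul_right]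
    refine ENNReal.tsum_le_tsum fun j => ?_
    rw [← ContinuousLinearMap.adjoint_inner_left, ← mul_pow]
    gcongr
    rw [← ofReal_norm, ← ofReal_norm, ← ofReal_norm, ← ENNReal.ofReal_mul (norm_nonneg _)]
    exact ENNReal.ofReal_le_ofReal (norm_inner_le_norm _ _)
  by_cases ht : h = ∞
  · simp [ht]
  have : ‖A‖ ≤ √h.toReal := by
    refine A.opNorm_le_bound (Real.sqrt_nonneg _) fun x => ?_
    rw [← abs_of_nonneg (norm_nonneg (A x)), ← Real.sqrt_sq (norm_nonneg x),
      ← Real.sqrt_mul ENNReal.toReal_nonneg]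
    refine Real.abs_le_sqrt ?_
    have h3 := ENNReal.toReal_mono (by finiteness) (key x)
    simpa using h3
  rw [← ofReal_norm, ← ENNReal.ofReal_pow (norm_nonneg _), ← ENNReal.ofReal_toReal ht]
  refine ENNReal.ofReal_le_ofReal ?_
  calc ‖A‖ ^ 2 ≤ √h.toReal ^ 2 := by gcongr
    _ = _ := Real.sq_sqrt ENNReal.toReal_nonneg

theorem hsNorm_sq (e : HilbertBasis ι ℂ H) (T : H →L[ℂ] H) :
    hsNorm e T ^ 2 = ∑' j, ‖T (e j)‖ₑ ^ 2 := by
  rw [hsNorm, ← ENNReal.rpow_natCast, ← ENNReal.rpow_mul]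
  norm_num

theorem enorm_le_hsNorm (e : HilbertBasis ι ℂ H) (T : H →L[ℂ] H) : ‖T‖ₑ ≤ hsNorm e T := by
  have := enorm_sq_le_tsum e T
  rw [← hsNorm_sq] at this
  exact (ENNReal.pow_le_pow_left_iff two_ne_zero).1 this

/-- The square root of `|T|` is a self-adjoint operator whose squared Hilbert-Schmidt norm is the
trace norm of `T`. -/
theorem exists_sqrt_abs (e : HilbertBasis ι ℂ H) (T : H →L[ℂ] H) :
    ∃ S : H →L[ℂ] H, ContinuousLinearMap.adjoint S = S ∧ S * S = CFC.abs T ∧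
      traceNorm e T = ∑' j, ‖S (e j)‖ₑ ^ 2 := by
  have hS : ContinuousLinearMap.adjoint (CFC.sqrt (CFC.abs T)) = CFC.sqrt (CFC.abs T) :=
    (CFC.sqrt_nonneg (CFC.abs T)).isSelfAdjoint.star_eq
  have hSS : CFC.sqrt (CFC.abs T) * CFC.sqrt (CFC.abs T) = CFC.abs T :=
    CFC.sqrt_mul_sqrt_self _ (CFC.abs_nonneg T)
  refine ⟨_, hS, hSS, tsum_congr fun j => ?_⟩
  generalize CFC.sqrt (CFC.abs T) = S at hS hSS ⊢
  rw [← hSS]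
  have : inner ℂ ((S * S) (e j)) (e j) = inner ℂ (S (e j)) (S (e j)) := by
    rw [← ContinuousLinearMap.adjoint_inner_left, hS]; rfl
  rw [this, ← norm_sq_eq_re_inner, ENNReal.ofReal_pow (norm_nonneg _), ofReal_norm]

theorem norm_abs_apply (T : H →L[ℂ] H) (x : H) : ‖CFC.abs T x‖ = ‖T x‖ := by
  have h1 : ContinuousLinearMap.adjoint (CFC.abs T) = CFC.abs T :=
    (CFC.abs_nonneg T).isSelfAdjoint.star_eq
  have h2 : CFC.abs T * CFC.abs T = ContinuousLinearMap.adjoint T * T := CFC.abs_mul_abs T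
  have h3 : inner ℂ (CFC.abs T x) (CFC.abs T x) = inner ℂ (T x) (T x) := by
    rw [← ContinuousLinearMap.adjoint_inner_left, h1,
      ← ContinuousLinearMap.adjoint_inner_left T]
    exact congrArg (fun A : H →L[ℂ] H => inner ℂ (A x) x) h2
  have h4 := congrArg (RCLike.re (K := ℂ)) h3
  rw [← norm_sq_eq_re_inner, ← norm_sq_eq_re_inner] at h4
  exact (pow_left_inj₀ (norm_nonneg _) (norm_nonneg _) two_ne_zero).1 h4

/-- With `S = |T|^{1/2}`, the squared Hilbert–Schmidt norm of `T` is that of `S * S`, hence at most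
`‖S‖² ‖S‖_HS² ≤ ‖S‖_HS⁴`, which is the squared trace norm. -/
theorem hsNorm_le_traceNorm (e : HilbertBasis ι ℂ H) (T : H →L[ℂ] H) :
    hsNorm e T ≤ traceNorm e T := by
  obtain ⟨S, -, hSS, htr⟩ := exists_sqrt_abs e T
  refine (ENNReal.pow_le_pow_left_iff two_ne_zero).1 ?_
  rw [hsNorm_sq]
  have : ∀ j, ‖T (e j)‖ₑ = ‖(S * S) (e j)‖ₑ := fun j => by
    rw [hSS, ← ofReal_norm, ← ofReal_norm, norm_abs_apply]
  simp_rw [this]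
  refine (tsum_enorm_mul_left_sq_le e S S).trans ?_
  rw [htr, sq (∑' j, _)]
  gcongr
  exact enorm_sq_le_tsum e S

/-- An approximate polar decomposition. -/
theorem exists_approx_polar (T : H →L[ℂ] H) {ε : ℝ} (hε : 0 < ε) :
    ∃ U : H →L[ℂ] H, ‖U‖ ≤ 1 ∧ T = U * CFC.abs T + (ε : ℂ) • U := by
  set A := CFC.abs T with hA
  have hA0 : 0 ≤ A := CFC.abs_nonneg T
  have hunit : IsUnit (A + (ε : ℂ) • (1 : H →L[ℂ] H)) := by
    have h1 : IsUnit ((ε : ℂ) • (1 : H →L[ℂ] H)) :=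
      IsUnit.smul (Units.mk0 (ε : ℂ) (by exact_mod_cast hε.ne')) isUnit_one
    have h0 : (0 : H →L[ℂ] H) ≤ (ε : ℂ) • (1 : H →L[ℂ] H) := by
      have : (ε : ℂ) • (1 : H →L[ℂ] H) = ε • (1 : H →L[ℂ] H) := by ext; simp
      rw [this]
      exact smul_nonneg hε.le zero_le_one
    refine CStarAlgebra.isUnit_of_le _ (le_add_of_nonneg_left hA0) (h1.isStrictlyPositive h0)
  obtain ⟨R, hR⟩ := hunit
  have hpos : ∀ y, ‖A y‖ ≤ ‖(A + (ε : ℂ) • (1 : H →L[ℂ] H)) y‖ := by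
    intro y
    have hp : 0 ≤ RCLike.re (inner ℂ (A y) y) :=
      ((ContinuousLinearMap.nonneg_iff_isPositive A).1 hA0).re_inner_nonneg_left y
    have h1 : ‖(A + (ε : ℂ) • (1 : H →L[ℂ] H)) y‖ ^ 2
        = ‖A y‖ ^ 2 + 2 * (ε * RCLike.re (inner ℂ (A y) y)) + ε ^ 2 * ‖y‖ ^ 2 := by
      have : (A + (ε : ℂ) • (1 : H →L[ℂ] H)) y = A y + (ε : ℂ) • y := by simp
      rw [this, norm_add_sq (𝕜 := ℂ), inner_smul_right, norm_smul]
      simp [mul_pow]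
    refine abs_le_of_sq_le_sq' ?_ (norm_nonneg _) |>.2
    rw [h1]
    have := mul_nonneg hε.le hp
    nlinarith [sq_nonneg (ε * ‖y‖)]
  -- The witness is `U = T (|T| + ε)⁻¹`. It is a contraction because `‖T y‖ = ‖|T| y‖`, and
  -- positivity of `|T|` makes this at most `‖(|T| + ε) y‖`.
  refine ⟨T * ↑R⁻¹, ?_, ?_⟩
  · refine ContinuousLinearMap.opNorm_le_bound _ zero_le_one fun x => ?_
    rw [one_mul]
    have h2 : (A + (ε : ℂ) • (1 : H →L[ℂ] H)) ((↑R⁻¹ : H →L[ℂ] H) x) = x := by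
      rw [← hR]
      exact congrArg (fun B : H →L[ℂ] H => B x) R.mul_inv
    calc ‖(T * ↑R⁻¹) x‖ = ‖A ((↑R⁻¹ : H →L[ℂ] H) x)‖ := (norm_abs_apply T _).symm
      _ ≤ _ := hpos _
      _ = ‖x‖ := by rw [h2]
  · have : T * ↑R⁻¹ * A + (ε : ℂ) • (T * (↑R⁻¹ : H →L[ℂ] H))
        = T * (↑R⁻¹ * (A + (ε : ℂ) • (1 : H →L[ℂ] H))) := by
      simp [mul_add, mul_assoc]
    rw [this, ← hR, R.inv_mul, mul_one]

/-- Writing `T = U S S + ε U` with `S = |T|^{1/2}`, each diagonal entry is `⟨S U* e_j, S e_j⟩` up to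
`ε`. By the arithmetic–geometric inequality the sum is controlled by the squared Hilbert–Schmidt
norms of `S U*` and `S`, both at most the trace norm. -/
theorem sum_norm_inner_le_traceNorm (e : HilbertBasis ι ℂ H) (T : H →L[ℂ] H)
    (hT : traceNorm e T ≠ ∞) (F : Finset ι) :
    ∑ j ∈ F, ‖inner ℂ (e j) (T (e j))‖ ≤ (traceNorm e T).toReal := by
  obtain ⟨S, hS, hSS, htr⟩ := exists_sqrt_abs e T
  have fin : ∀ B : H →L[ℂ] H, ∑' j, ‖B (e j)‖ₑ ^ 2 ≤ traceNorm e T →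
      ∑ j ∈ F, ‖B (e j)‖ ^ 2 ≤ (traceNorm e T).toReal := by
    intro B hB
    have h1 := (ENNReal.sum_le_tsum (f := fun j => ‖B (e j)‖ₑ ^ 2) F).trans hB
    have h2 := ENNReal.toReal_mono hT h1
    rw [ENNReal.toReal_sum (by intros; finiteness)] at h2
    simpa using h2
  refine le_of_forall_pos_le_add fun δ hδ => ?_
  -- Each index of `F` contributes an error `ε`, so the total error stays below `δ`.
  set ε : ℝ := δ / (F.card + 1) with hεdef
  have hε : 0 < ε := by positivity
  obtain ⟨U, hU, hTU⟩ := exists_approx_polar T hε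
  have hU' : ‖ContinuousLinearMap.adjoint U‖ₑ ≤ 1 := by
    rw [← ofReal_norm, LinearIsometryEquiv.norm_map]
    exact ENNReal.ofReal_le_one.2 hU
  have hb1 := fin S htr.ge
  have hb2 := fin (S * ContinuousLinearMap.adjoint U) (by
    refine (tsum_enorm_mul_right_sq_le e S _).trans ?_
    rw [← htr]
    exact mul_le_of_le_one_left (by positivity) (pow_le_one₀ (by positivity) hU'))
  have hterm : ∀ j, ‖inner ℂ (e j) (T (e j))‖
      ≤ (‖(S * ContinuousLinearMap.adjoint U) (e j)‖ ^ 2 + ‖S (e j)‖ ^ 2) / 2 + ε := by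
    intro j
    have h1 : inner ℂ (e j) (T (e j))
        = inner ℂ ((S * ContinuousLinearMap.adjoint U) (e j)) (S (e j))
          + (ε : ℂ) * inner ℂ (e j) (U (e j)) := by
      conv_lhs => rw [hTU, ← hSS]
      have : (U * (S * S) + (ε : ℂ) • U) (e j) = U (S (S (e j))) + (ε : ℂ) • U (e j) := rfl
      rw [this, inner_add_right, inner_smul_right, ← ContinuousLinearMap.adjoint_inner_left]
      congr 1
      conv_lhs => rw [← hS, ContinuousLinearMap.adjoint_inner_right, hS]
      rfl
    have hej : ‖e j‖ = 1 := e.orthonormal.1 j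
    have h2 : ‖inner ℂ (e j) (U (e j))‖ ≤ 1 := by
      refine (norm_inner_le_norm _ _).trans ?_
      rw [hej, one_mul]
      exact (U.le_of_opNorm_le hU (e j)).trans_eq (by rw [hej, one_mul])
    rw [h1]
    refine (norm_add_le _ _).trans (add_le_add ?_ ?_)
    · refine (norm_inner_le_norm _ _).trans ?_
      nlinarith [sq_nonneg (‖(S * ContinuousLinearMap.adjoint U) (e j)‖ - ‖S (e j)‖)]
    · rw [norm_mul, Complex.norm_real, Real.norm_of_nonneg hε.le]
      exact mul_le_of_le_one_right hε.le h2
  refine (Finset.sum_le_sum fun j _ => hterm j).trans ?_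
  rw [Finset.sum_add_distrib, ← Finset.sum_div, Finset.sum_add_distrib, Finset.sum_const,
    nsmul_eq_mul]
  have : (F.card : ℝ) * ε ≤ δ := by
    have hF : (0 : ℝ) < F.card + 1 := Nat.cast_add_one_pos _
    rw [hεdef, mul_div_assoc', div_le_iff₀ hF]
    linarith
  linarith

/-! ### Hilbert-Schmidt operators as square-summable families -/

/-- The square-summable family `v` consists of the images of the basis vectors under `T`. -/
def RepresentsHS (e : HilbertBasis ι ℂ H) (T : H →L[ℂ] H) (v : lp (fun _ : ι => H) 2) : Prop :=
  ∀ j, v j = T (e j)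

namespace RepresentsHS

variable {e : HilbertBasis ι ℂ H} {A B : H →L[ℂ] H} {v w : lp (fun _ : ι => H) 2}

theorem hsNorm_eq (h : RepresentsHS e A v) : hsNorm e A = ‖v‖ₑ := by
  refine (ENNReal.pow_right_strictMono two_ne_zero).injective ?_
  rw [hsNorm_sq]
  have h1 := lp.hasSum_norm (p := 2) (by norm_num) v
  simp only [ENNReal.toReal_ofNat, Real.rpow_ofNat] at h1
  have h2 := ENNReal.ofReal_tsum_of_nonneg (fun j => by positivity) h1.summable
  rw [h1.tsum_eq] at h2
  simp only [ENNReal.ofReal_pow (norm_nonneg _), ofReal_norm] at h2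
  rw [h2]
  exact tsum_congr fun j => by rw [h j]

theorem hsInner_eq (hA : RepresentsHS e A v) (hB : RepresentsHS e B w) :
    hsInner e A B = inner ℂ v w := by
  rw [lp.inner_eq_tsum, hsInner]
  exact tsum_congr fun j => by rw [hA j, hB j]

theorem sub (hA : RepresentsHS e A v) (hB : RepresentsHS e B w) :
    RepresentsHS e (A - B) (v - w) := fun j => by
  simp [hA j, hB j]

theorem smul (hA : RepresentsHS e A v) (c : ℂ) : RepresentsHS e (c • A) (c • v) := fun j => by
  simp [hA j]

theorem sum {κ : Type*} {s : Finset κ} {A : κ → H →L[ℂ] H} {v : κ → lp (fun _ : ι => H) 2}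
    (h : ∀ k ∈ s, RepresentsHS e (A k) (v k)) :
    RepresentsHS e (∑ k ∈ s, A k) (∑ k ∈ s, v k) := fun j => by
  rw [lp.coeFn_sum, Finset.sum_apply, sum_apply]
  exact Finset.sum_congr rfl fun k hk => h k hk j

end RepresentsHS

/-- Evaluation of a square-summable family at an index. -/
def lpEval (H : Type*) [NormedAddCommGroup H] [InnerProductSpace ℂ H] {ι : Type*} (j : ι) :
    lp (fun _ : ι => H) 2 →L[ℂ] H :=
  LinearMap.mkContinuous
    { toFun := fun v => v j
      map_add' := fun _ _ => rfl
      map_smul' := fun _ _ => rfl } 1 (fun v => by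
        rw [one_mul]
        exact lp.norm_apply_le_norm two_ne_zero v j)

@[simp]
theorem lpEval_apply (j : ι) (v : lp (fun _ : ι => H) 2) : lpEval H j v = v j := rfl

theorem RepresentsHS.tsum {e : HilbertBasis ι ℂ H} {κ : Type*} {A : κ → H →L[ℂ] H}
    {v : κ → lp (fun _ : ι => H) 2} (hA : Summable A) (hv : Summable v)
    (h : ∀ k, RepresentsHS e (A k) (v k)) :
    RepresentsHS e (∑' k, A k) (∑' k, v k) := fun j => by
  rw [← lpEval_apply, ContinuousLinearMap.map_tsum _ hv]
  have := ContinuousLinearMap.map_tsum (ContinuousLinearMap.apply ℂ H (e j)) hA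
  simp only [ContinuousLinearMap.apply_apply] at this
  rw [this]
  exact tsum_congr fun k => h k j

theorem hasSum_norm_inner_sq (e : HilbertBasis ι ℂ H) (x : H) :
    HasSum (fun j => ‖inner ℂ (e j) x‖ ^ 2) (‖x‖ ^ 2) := by
  have h := lp.hasSum_norm (p := 2) (by norm_num) (e.repr x)
  simpa only [e.repr.norm_map, e.repr_apply_apply, ENNReal.toReal_ofNat, Real.rpow_ofNat] using h

/-- The family representing the operator `x ⊗ y`. -/
def hsRankOneFamily (e : HilbertBasis ι ℂ H) (x y : H) : lp (fun _ : ι => H) 2 :=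
  ⟨fun j => inner ℂ y (e j) • x, by
    refine memℓp_gen ?_
    have := ((hasSum_norm_inner_sq e y).mul_right (‖x‖ ^ 2)).summable
    refine this.congr fun j => ?_
    simp [norm_smul, mul_pow, norm_inner_symm y (e j)]⟩

theorem representsHS_hsRankOneFamily (e : HilbertBasis ι ℂ H) (x y : H) :
    RepresentsHS e (InnerProductSpace.rankOne ℂ x y) (hsRankOneFamily e x y) := fun j => by
  simp [hsRankOneFamily]

theorem norm_hsRankOneFamily (e : HilbertBasis ι ℂ H) (x y : H) :
    ‖hsRankOneFamily e x y‖ = ‖x‖ * ‖y‖ := by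
  have h := lp.hasSum_norm (p := 2) (by norm_num) (hsRankOneFamily e x y)
  have h2 := (hasSum_norm_inner_sq e y).mul_right (‖x‖ ^ 2)
  have h3 : (fun j => ‖hsRankOneFamily e x y j‖ ^ (2 : ℝ≥0∞).toReal)
      = fun j => ‖inner ℂ (e j) y‖ ^ 2 * ‖x‖ ^ 2 := by
    ext j
    simp [hsRankOneFamily, norm_smul, mul_pow, norm_inner_symm y (e j)]
  rw [h3] at h
  have h4 := h.unique h2
  simp only [ENNReal.toReal_ofNat, Real.rpow_ofNat] at h4
  rw [← mul_pow] at h4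
  rw [mul_comm]
  exact (pow_left_inj₀ (norm_nonneg _) (by positivity) two_ne_zero).1 h4

/-- The sesquilinear map sending `x`, `y` to the family representing `x ⊗ y`. -/
def hsRankOne (e : HilbertBasis ι ℂ H) : H →L[ℂ] H →L⋆[ℂ] lp (fun _ : ι => H) 2 :=
  LinearMap.mkContinuous₂
    (LinearMap.mk₂'ₛₗ (RingHom.id ℂ) (starRingEnd ℂ) (hsRankOneFamily e)
      (fun _ _ _ => by ext j; exact smul_add _ _ _)
      (fun c _ _ => by ext j; exact smul_comm _ c _)
      (fun x y y' => by
        ext j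
        change inner ℂ (y + y') (e j) • x = inner ℂ y (e j) • x + inner ℂ y' (e j) • x
        rw [inner_add_left, add_smul])
      (fun c x y => by
        ext j
        change inner ℂ (c • y) (e j) • x = (starRingEnd ℂ) c • inner ℂ y (e j) • x
        rw [inner_smul_left, mul_smul]))
    1 (fun x y => by
      rw [one_mul]
      exact (norm_hsRankOneFamily e x y).le)

theorem norm_hsRankOne (e : HilbertBasis ι ℂ H) (x y : H) :
    ‖hsRankOne e x y‖ = ‖x‖ * ‖y‖ := norm_hsRankOneFamily e x y

theorem representsHS_hsRankOne (e : HilbertBasis ι ℂ H) (x y : H) :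
    RepresentsHS e (InnerProductSpace.rankOne ℂ x y) (hsRankOne e x y) :=
  representsHS_hsRankOneFamily e x y

/-- Distinct basis vectors are at distance `√2`, so balls of radius `1/2` around them are disjoint.
Countability is what allows expectations to be exchanged with basis expansions. -/
theorem countable_of_hilbertBasis [TopologicalSpace.SeparableSpace H] (e : HilbertBasis ι ℂ H) :
    Countable ι := by
  have hpd : Pairwise (Function.onFun Disjoint fun i => Metric.ball (e i) (1 / 2)) := by
    intro i j hij
    refine Metric.ball_disjoint_ball ?_
    have h : ‖e i - e j‖ ^ 2 = 2 := by
      rw [@norm_sub_sq ℂ, e.orthonormal.1 i, e.orthonormal.1 j, e.orthonormal.2 hij]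
      norm_num
    rw [dist_eq_norm]
    nlinarith [norm_nonneg (e i - e j)]
  exact hpd.countable_of_isOpen_disjoint (fun i => Metric.isOpen_ball)
    (fun i => ⟨e i, Metric.mem_ball_self (by norm_num)⟩)

end OperatorLemmas

section FourierUniqueness

/-! ### Uniqueness of Fourier coefficients -/

local instance : MeasureSpace UnitAddCircle := ⟨AddCircle.haarAddCircle⟩

local instance : IsProbabilityMeasure (volume : Measure UnitAddCircle) :=
  inferInstanceAs (IsProbabilityMeasure AddCircle.haarAddCircle)

theorem character_eq_mFourier {d : ℕ} (k : Fin d → ℤ) (x : Fin d → ℝ) :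
    character k (fun i => 2 * Real.pi * x i)
      = UnitAddTorus.mFourier k (fun i => (x i : UnitAddCircle)) := by
  simp only [character, UnitAddTorus.mFourier, ContinuousMap.coe_mk, fourier_coe_apply,
    ← Complex.exp_sum]
  congr 1
  push_cast
  rw [Finset.mul_sum]
  exact Finset.sum_congr rfl fun i _ => by ring

theorem norm_character {d : ℕ} (k : Fin d → ℤ) (θ : Fin d → ℝ) : ‖character k θ‖ = 1 := by
  rw [character, mul_comm, Complex.norm_exp_ofReal_mul_I]

/-- The series converges uniformly on the torus, so it may be paired termwise in `L²` with the
`j`-th monomial, and orthonormality leaves only `a j`. -/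
theorem eq_zero_of_tsum_character_eq_zero {d : ℕ} {a : (Fin d → ℤ) → ℂ} (ha : Summable a)
    (h : ∀ θ, ∑' k, character k θ * a k = 0) : a = 0 := by
  have hs : Summable fun k => a k • (UnitAddTorus.mFourier k : C(UnitAddTorus (Fin d), ℂ)) := by
    refine Summable.of_norm ?_
    simpa [norm_smul, UnitAddTorus.mFourier_norm] using ha.norm
  have h0 : ∑' k, a k • (UnitAddTorus.mFourier k : C(UnitAddTorus (Fin d), ℂ)) = 0 := by
    ext x
    have hx : ∃ y : Fin d → ℝ, (fun i => (y i : UnitAddCircle)) = x :=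
      ⟨fun i => (x i).out, by ext i; exact Quotient.out_eq _⟩
    obtain ⟨y, rfl⟩ := hx
    have h' := ContinuousMap.tsum_apply hs (fun i => (y i : UnitAddCircle))
    rw [← h', ContinuousMap.zero_apply, ← h fun i => 2 * Real.pi * y i]
    refine tsum_congr fun k => ?_
    rw [character_eq_mFourier]
    simp [mul_comm]
  have h1 := ContinuousLinearMap.map_tsum
    (ContinuousMap.toLp (E := ℂ) 2 (volume : Measure (UnitAddTorus (Fin d))) ℂ) hs
  have hs1 := (ContinuousMap.toLp (E := ℂ) 2
    (volume : Measure (UnitAddTorus (Fin d))) ℂ).summable hs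
  rw [h0, map_zero] at h1
  simp only [map_smul] at h1 hs1
  funext j
  have h2 := ContinuousLinearMap.map_tsum
    (innerSL ℂ (UnitAddTorus.mFourierLp 2 j)) hs1
  rw [← h1, map_zero] at h2
  have h3 : ∀ k, innerSL ℂ (UnitAddTorus.mFourierLp 2 j)
      (a k • ContinuousMap.toLp (E := ℂ) 2 (volume : Measure (UnitAddTorus (Fin d))) ℂ
        (UnitAddTorus.mFourier k)) = if k = j then a k else 0 := by
    intro k
    rw [innerSL_apply_apply, inner_smul_right]
    have := orthonormal_iff_ite.1 (UnitAddTorus.orthonormal_mFourier (d := Fin d)) j k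
    unfold UnitAddTorus.mFourierLp at this ⊢
    rw [this]
    by_cases hjk : k = j
    · simp [hjk]
    · simp [hjk, Ne.symm hjk]
  simp_rw [h3] at h2
  rw [tsum_ite_eq] at h2
  simpa using h2.symm

variable {H : Type*} [NormedAddCommGroup H] [InnerProductSpace ℂ H] [CompleteSpace H]

theorem fourierSeries_injOn_summable {d : ℕ} {A B : (Fin d → ℤ) → H →L[ℂ] H}
    (hA : Summable fun k => ‖A k‖) (hB : Summable fun k => ‖B k‖)
    (h : fourierSeries A = fourierSeries B) : A = B := by
  have hsum : ∀ C : (Fin d → ℤ) → H →L[ℂ] H, (Summable fun k => ‖C k‖) → ∀ θ,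
      Summable fun k => character k θ • C k := fun C hC θ => by
    refine Summable.of_norm ?_
    simpa [norm_smul, norm_character] using hC
  have key : ∀ x y : H, (fun k => inner ℂ y ((A k - B k) x)) = 0 := by
    intro x y
    have hD : Summable fun k => ‖A k - B k‖ :=
      (hA.add hB).of_nonneg_of_le (fun _ => norm_nonneg _) fun k => norm_sub_le _ _
    obtain ⟨φ, hφ⟩ : ∃ φ : (H →L[ℂ] H) →L[ℂ] ℂ, ∀ T, φ T = inner ℂ y (T x) :=
      ⟨(innerSL ℂ y) ∘L ContinuousLinearMap.apply ℂ H x, fun T => rfl⟩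
    simp_rw [← hφ]
    refine eq_zero_of_tsum_character_eq_zero ?_ fun θ => ?_
    · exact φ.summable hD.of_norm
    · have h1 := congrFun h θ
      unfold fourierSeries at h1
      have hne : ((((2 * Real.pi) ^ d : ℝ) : ℂ)⁻¹) ≠ 0 :=
        inv_ne_zero (by exact_mod_cast (by positivity : (2 * Real.pi) ^ d ≠ 0))
      have h2 := smul_right_injective (H →L[ℂ] H) hne h1
      have h3 := (hsum A hA θ).tsum_sub (hsum B hB θ)
      rw [h2, sub_self] at h3
      have h4 := ContinuousLinearMap.map_tsum φ ((hsum A hA θ).sub (hsum B hB θ))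
      rw [h3, map_zero] at h4
      rw [h4]
      refine tsum_congr fun k => ?_
      rw [← smul_sub, map_smul, smul_eq_mul]
  funext k
  ext x
  -- Testing against the vector `(A k - B k) x` itself turns the vanishing matrix entry into a
  -- vanishing norm.
  have h1 := congrFun (key x ((A k - B k) x)) k
  simp only [Pi.zero_apply, inner_self_eq_zero] at h1
  simpa [sub_eq_zero] using h1

end FourierUniqueness

section KernelLemmas

/-! ### Mean value estimates along coordinate paths -/

variable {d : ℕ}

theorem abs_sub_le_of_lineDeriv_le {g : EuclideanSpace ℝ (Fin d) → ℝ}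
    {v : EuclideanSpace ℝ (Fin d)} (hg : ∀ x, LineDifferentiableAt ℝ g x v) {B : ℝ}
    (x : EuclideanSpace ℝ (Fin d)) (s : ℝ)
    (hB : ∀ σ ∈ Set.uIcc 0 s, |lineDeriv ℝ g (x + σ • v) v| ≤ B) :
    |g (x + s • v) - g x| ≤ B * |s| := by
  have hd : ∀ σ, HasDerivAt (fun τ : ℝ => g (x + τ • v)) (lineDeriv ℝ g (x + σ • v) v) σ := by
    intro σ
    have h1 : HasDerivAt (fun τ : ℝ => g (x + σ • v + τ • v)) (lineDeriv ℝ g (x + σ • v) v)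
        (σ - σ) := by
      rw [sub_self]
      exact (hg (x + σ • v)).hasLineDerivAt
    refine (h1.comp_sub_const σ σ).congr_of_eventuallyEq (Eventually.of_forall fun τ => ?_)
    beta_reduce
    congr 1
    module
  have h2 := (convex_uIcc (0 : ℝ) s).norm_image_sub_le_of_norm_hasDerivWithin_le
    (fun σ _ => (hd σ).hasDerivWithinAt) hB Set.left_mem_uIcc Set.right_mem_uIcc
  simpa using h2

/-- The coordinates of `u` are switched on one at a time. Such a path stays in the box `|y j| ≤ |u
j|`, and only partial derivatives are needed, not joint differentiability. -/
theorem abs_sub_le_of_partial_le {g : EuclideanSpace ℝ (Fin d) → ℝ}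
    (hg : ∀ i x, LineDifferentiableAt ℝ g x (EuclideanSpace.single i 1))
    (u : EuclideanSpace ℝ (Fin d)) {b : ℝ}
    (hb : ∀ i y, (∀ j, |y j| ≤ |u j|) → |lineDeriv ℝ g y (EuclideanSpace.single i 1)| ≤ b) :
    |g u - g 0| ≤ b * ∑ j, |u j| := by
  have key : ∀ s : Finset (Fin d),
      |g (WithLp.toLp 2 (fun j => if j ∈ s then u j else 0)) - g 0| ≤ b * ∑ j ∈ s, |u j| := by
    intro s
    induction s using Finset.induction_on with
    | empty =>
      have h0 : WithLp.toLp 2 (fun j : Fin d => if j ∈ (∅ : Finset (Fin d)) then u j else 0)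
          = (0 : EuclideanSpace ℝ (Fin d)) := by ext j; simp
      rw [h0]
      simp
    | insert i s hi ih =>
      set x : EuclideanSpace ℝ (Fin d) := WithLp.toLp 2 (fun j => if j ∈ s then u j else 0)
        with hx
      have h1 : WithLp.toLp 2 (fun j : Fin d => if j ∈ insert i s then u j else 0)
          = x + u i • EuclideanSpace.single i (1 : ℝ) := by
        ext j
        by_cases hj : j = i
        · subst hj; simp [hx, hi]
        · simp [hx, hj]
      have h2 := abs_sub_le_of_lineDeriv_le (hg i) x (u i) (B := b) (fun σ hσ => by
        refine hb i _ fun j => ?_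
        by_cases hj : j = i
        · subst hj
          have : |σ| ≤ |u j| := by
            have := Set.abs_sub_left_of_mem_uIcc hσ
            simpa using this
          simpa [hx, hi] using this
        · by_cases hjs : j ∈ s <;> simp [hx, hj, hjs])
      rw [h1, Finset.sum_insert hi, mul_add]
      calc |g (x + u i • EuclideanSpace.single i (1 : ℝ)) - g 0|
          ≤ |g (x + u i • EuclideanSpace.single i (1 : ℝ)) - g x| + |g x - g 0| :=
            abs_sub_le _ _ _
        _ ≤ _ := add_le_add h2 ih
  have := key Finset.univ
  simpa using this

/-! ### Behaviour of a flat kernel at the origin -/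

theorem exists_iterPartial_bound {K : EuclideanSpace ℝ (Fin d) → ℝ} {r : ℕ}
    (hKr : IsFlatToOrder K r) :
    ∃ B : ℝ, 0 ≤ B ∧ ∀ a : List (Fin d), a.length = r + 1 → ∀ x, |iterPartial K a x| ≤ B := by
  choose! B hB using hKr.partial_bounded
  have hfin : {a : List (Fin d) | a.length = r + 1}.Finite := List.finite_length_eq _ _
  obtain ⟨M, hM⟩ := (hfin.image B).bddAbove
  exact ⟨max M 0, le_max_right _ _, fun a ha x =>
    (hB a ha x).trans ((hM ⟨a, ha, rfl⟩).trans (le_max_left _ _))⟩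

theorem abs_kernel_sub_le_pow {K : EuclideanSpace ℝ (Fin d) → ℝ} {r : ℕ}
    (hKr : IsFlatToOrder K r) :
    ∃ B : ℝ, 0 ≤ B ∧ ∀ u, |K u - K 0| ≤ B * (∑ j, |u j|) ^ (r + 1) := by
  obtain ⟨B, hB0, hB⟩ := exists_iterPartial_bound hKr
  have hmono : ∀ (m : ℕ) (u y : EuclideanSpace ℝ (Fin d)), (∀ j, |y j| ≤ |u j|) →
      B * (∑ j, |y j|) ^ m ≤ B * (∑ j, |u j|) ^ m := fun m u y h => by
    have := Finset.sum_le_sum fun j (_ : j ∈ Finset.univ) => h j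
    gcongr B * ?_ ^ m
  -- Induction downwards in the order of the derivative replaces Taylor's formula: a partial of
  -- order `r + 1 - m` vanishes at `0`, and its own partials are already known to be of size `(∑ |u
  -- j|) ^ (m - 1)`.
  have key : ∀ (m : ℕ) (a : List (Fin d)), a.length + m = r + 1 → 1 ≤ a.length → ∀ u,
      |iterPartial K a u| ≤ B * (∑ j, |u j|) ^ m := by
    intro m
    induction m with
    | zero => intro a ha _ u; simpa using hB a ha u
    | succ m ih =>
      intro a ha h1 u
      have h2 := abs_sub_le_of_partial_le (g := iterPartial K a)
        (fun i x => hKr.exists_partial a (by omega) i x) u (b := B * (∑ j, |u j|) ^ m)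
        (fun i y hy => (ih (i :: a) (by simp; omega) (by simp) y).trans (hmono m u y hy))
      rw [hKr.partial_zero a h1 (by omega)] at h2
      rw [pow_succ, ← mul_assoc]
      simpa using h2
  refine ⟨B, hB0, fun u => ?_⟩
  have h2 := abs_sub_le_of_partial_le (g := K)
    (fun i x => hKr.exists_partial [] (by simp) i x) u (b := B * (∑ j, |u j|) ^ r)
    (fun i y hy => (key r [i] (by simp; omega) (by simp) y).trans (hmono r u y hy))
  rwa [pow_succ, ← mul_assoc]

theorem abs_coord_le_norm (u : EuclideanSpace ℝ (Fin d)) (j : Fin d) : |u j| ≤ ‖u‖ :=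
  PiLp.norm_apply_le u j

/-- In the unit ball flatness gives the power `r + 1 > β`; outside it `0 ≤ K ≤ 1` suffices since
`‖u‖ ^ β ≥ 1`. -/
theorem abs_kernel_sub_one_le {K : EuclideanSpace ℝ (Fin d) → ℝ} (hK : IsKernel K) {r : ℕ}
    (hKr : IsFlatToOrder K r) {β : ℝ} (hβ : 0 < β) (hr : β - 1 < r) :
    ∃ c : ℝ, 0 ≤ c ∧ ∀ u, |K u - 1| ≤ c * ‖u‖ ^ β := by
  obtain ⟨B, hB0, hB⟩ := abs_kernel_sub_le_pow hKr
  refine ⟨max 1 (B * (d : ℝ) ^ (r + 1)), by positivity, fun u => ?_⟩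
  rcases le_total ‖u‖ 1 with h | h
  · have h1 := hB u
    rw [hK.map_zero] at h1
    have h2 : ∑ j, |u j| ≤ d * ‖u‖ := by
      refine (Finset.sum_le_sum fun j _ => abs_coord_le_norm u j).trans ?_
      simp
    calc |K u - 1| ≤ B * (d * ‖u‖) ^ (r + 1) := h1.trans (by gcongr)
      _ = B * (d : ℝ) ^ (r + 1) * ‖u‖ ^ (r + 1) := by ring
      _ ≤ B * (d : ℝ) ^ (r + 1) * ‖u‖ ^ β := by
        gcongr
        rw [← Real.rpow_natCast]
        refine Real.rpow_le_rpow_of_exponent_ge' (norm_nonneg _) h hβ.le ?_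
        push_cast
        linarith
      _ ≤ _ := by gcongr; exact le_max_right _ _
  · have h1 : |K u - 1| ≤ 1 := by
      rw [abs_le]
      constructor <;> linarith [hK.nonneg u, hK.le_one u]
    have h2 : 1 ≤ ‖u‖ ^ β := Real.one_le_rpow h hβ.le
    exact h1.trans (one_le_mul_of_one_le_of_one_le (le_max_left _ _) h2)

/-! ### Lipschitz continuity and boundary decay -/

theorem iterPartial_eq_zero_of_norm_gt {K : EuclideanSpace ℝ (Fin d) → ℝ} {R : ℝ}
    (hR : ∀ u, R < ‖u‖ → K u = 0) :
    ∀ (a : List (Fin d)) (u), R < ‖u‖ → iterPartial K a u = 0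
  | [], u, hu => hR u hu
  | i :: a, u, hu => by
    have h : iterPartial K a =ᶠ[𝓝 u] 0 := by
      filter_upwards [continuous_norm.continuousAt.eventually (lt_mem_nhds hu)] with x hx
      exact iterPartial_eq_zero_of_norm_gt hR a x hx
    change lineDeriv ℝ (iterPartial K a) u _ = 0
    rw [h.lineDeriv_eq]
    simp [lineDeriv]

/-- Only the partials of order `r + 1` are assumed bounded. A lower one vanishes outside the ball of
radius `R`, and a move of length `2 R + 1` along a coordinate leaves that ball, so its size is
bounded through the next order. -/
theorem exists_partial_bound {K : EuclideanSpace ℝ (Fin d) → ℝ} {r : ℕ}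
    (hKr : IsFlatToOrder K r) {R : ℝ} (hR0 : 0 ≤ R) (hR : ∀ u, R < ‖u‖ → K u = 0) :
    ∃ B : ℝ, 0 ≤ B ∧ ∀ i x, |lineDeriv ℝ K x (EuclideanSpace.single i 1)| ≤ B := by
  have key : ∀ (m : ℕ) (a : List (Fin d)), a.length + m = r + 1 → 1 ≤ a.length →
      ∃ B, ∀ x, |iterPartial K a x| ≤ B := by
    intro m
    induction m with
    | zero => intro a ha _; exact hKr.partial_bounded a ha
    | succ m ih =>
      intro a ha h1
      have i : Fin d := a.head (List.ne_nil_of_length_pos h1)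
      obtain ⟨B, hB⟩ := ih (i :: a) (by simp; omega) (by simp)
      have hB0 : 0 ≤ B := (abs_nonneg _).trans (hB 0)
      refine ⟨B * |2 * R + 1|, fun x => ?_⟩
      rcases le_or_gt ‖x‖ R with hx | hx
      · have h2 := abs_sub_le_of_lineDeriv_le (g := iterPartial K a) (v := EuclideanSpace.single i 1)
          (fun x => hKr.exists_partial a (by omega) i x) x (2 * R + 1) (fun σ _ => hB _)
        have h3 : iterPartial K a (x + (2 * R + 1) • EuclideanSpace.single i (1 : ℝ)) = 0 := by
          refine iterPartial_eq_zero_of_norm_gt hR a _ ?_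
          have h4 := norm_sub_norm_le ((2 * R + 1) • EuclideanSpace.single i (1 : ℝ)) (-x)
          rw [norm_smul, norm_neg, sub_neg_eq_add, add_comm _ x] at h4
          simp only [PiLp.norm_single, norm_one, mul_one, Real.norm_eq_abs] at h4
          have := le_abs_self (2 * R + 1)
          linarith
        rw [h3, zero_sub, abs_neg] at h2
        exact h2
      · rw [iterPartial_eq_zero_of_norm_gt hR a x hx, abs_zero]
        positivity
  choose B hB using fun i : Fin d => key r [i] (by simp; omega) (by simp)
  refine ⟨∑ i, |B i|, Finset.sum_nonneg fun _ _ => abs_nonneg _, fun i x => ?_⟩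
  refine (hB i x).trans ((le_abs_self _).trans ?_)
  exact Finset.single_le_sum (f := fun i => |B i|) (fun _ _ => abs_nonneg _) (Finset.mem_univ i)

theorem abs_lt_of_mem_grid_sub_grid {N : Fin d → ℕ} {k : Fin d → ℤ}
    (hk : k ∈ grid N - grid N) (l : Fin d) : |k l| < N l := by
  obtain ⟨t, ht, s, hs, rfl⟩ := Finset.mem_sub.1 hk
  simp only [grid, Finset.mem_Icc, Pi.le_def] at ht hs
  have h1 := ht.1 l
  have h2 := ht.2 l
  have h3 := hs.1 l
  have h4 := hs.2 l
  simp only [Pi.one_apply] at h1 h3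
  rw [Pi.sub_apply, abs_lt]
  constructor <;> linarith

theorem kernel_pos_iff {K : EuclideanSpace ℝ (Fin d) → ℝ} {Δ : ℝ} (hΔ : 0 < Δ)
    (k : Fin d → ℤ) :
    0 < K (Δ⁻¹ • latticePt k) ↔ latticePt k ∈ Δ • kernelSupport K := by
  rw [Set.mem_smul_set_iff_inv_smul_mem₀ hΔ.ne']
  rfl

theorem latticePt_update_add (h : Fin d → ℤ) (l : Fin d) (m : ℤ) :
    latticePt (h + Pi.single l m) = latticePt h + (m : ℝ) • EuclideanSpace.single l (1 : ℝ) := by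
  ext j
  by_cases hj : j = l
  · subst hj; simp [latticePt]
  · simp [latticePt, hj]

/-- A kernel whose rescaled support stays within the lags of a grid decays linearly towards the
boundary of the set of lags. -/
theorem exists_kernel_mul_le {K : EuclideanSpace ℝ (Fin d) → ℝ} (hK : IsKernel K) {r : ℕ}
    (hKr : IsFlatToOrder K r) :
    ∃ R C : ℝ, 0 ≤ R ∧ 0 ≤ C ∧ (∀ u, R < ‖u‖ → K u = 0) ∧
      ∀ (N : Fin d → ℕ) (Δ : ℝ), 0 < Δ →
        (∀ k : Fin d → ℤ, latticePt k ∈ Δ • kernelSupport K → k ∈ grid N - grid N) →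
        ∀ h ∈ grid N - grid N, ∀ l,
          K (Δ⁻¹ • latticePt h) * N l ≤ C * (N l - |(h l : ℝ)|) := by
  obtain ⟨R, hR⟩ := hK.bounded_support.subset_closedBall 0
  have hR' : ∀ u, max R 0 < ‖u‖ → K u = 0 := by
    intro u hu
    by_contra hne
    have h1 : u ∈ kernelSupport K := lt_of_le_of_ne (hK.nonneg u) (Ne.symm hne)
    have h2 := hR h1
    rw [mem_closedBall_zero_iff] at h2
    linarith [le_max_left R 0]
  have hR0 : 0 ≤ max R 0 := le_max_right _ _
  generalize max R 0 = R at hR' hR0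
  obtain ⟨B, hB0, hB⟩ := exists_partial_bound hKr hR0 hR'
  refine ⟨R, 2 + 2 * R * B, hR0, by positivity, hR', fun N Δ hΔ hsupp h hh l => ?_⟩
  have hlt : |(h l : ℝ)| < N l := by exact_mod_cast abs_lt_of_mem_grid_sub_grid hh l
  have hK0 := hK.nonneg (Δ⁻¹ • latticePt h)
  -- Away from the edge `N l ≤ 2 (N l - |h l|)` and `K ≤ 1` suffice. Otherwise, where `K` does not
  -- vanish, `N l < 2 |h l| ≤ 2 R Δ`, so that `N l` is at most of order `Δ`.
  rcases le_or_gt (2 * |(h l : ℝ)|) (N l) with hgood | hbad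
  · have h1 : K (Δ⁻¹ • latticePt h) * N l ≤ 1 * N l := by
      gcongr
      exact hK.le_one _
    have h2 : 0 ≤ 2 * R * B * (N l - |(h l : ℝ)|) :=
      mul_nonneg (by positivity) (by linarith)
    nlinarith
  by_cases hKz : K (Δ⁻¹ • latticePt h) = 0
  · rw [hKz, zero_mul]
    exact mul_nonneg (by positivity) (by linarith)
  have hnorm : ‖Δ⁻¹ • latticePt h‖ ≤ R := by
    by_contra hcon
    exact hKz (hR' _ (not_le.1 hcon))
  have hΔR : |(h l : ℝ)| ≤ R * Δ := by
    have h1 := (abs_coord_le_norm (Δ⁻¹ • latticePt h) l).trans hnorm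
    have h2 : (Δ⁻¹ • latticePt h) l = Δ⁻¹ * h l := by simp [latticePt]
    rw [h2, abs_mul, abs_of_pos (inv_pos.2 hΔ), inv_mul_le_iff₀ hΔ] at h1
    linarith
  -- Shifting coordinate `l` by `m` reaches the first lag outside the grid differences, where the
  -- support condition forces `K = 0`. The mean value bound over the rescaled distance `(N l - |h
  -- l|) / Δ` then gives the decay.
  obtain ⟨m, hm1, hm2⟩ : ∃ m : ℤ, |(m : ℝ)| = N l - |(h l : ℝ)| ∧ |h l + m| = N l := by
    rcases le_total 0 (h l) with hs | hs
    · refine ⟨N l - |h l|, ?_, ?_⟩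
      · push_cast
        exact abs_of_nonneg (by linarith)
      · rw [abs_of_nonneg hs]
        simp
    · refine ⟨-(N l - |h l|), ?_, ?_⟩
      · push_cast
        rw [abs_neg]
        exact abs_of_nonneg (by linarith)
      · rw [abs_of_nonpos hs]
        simp
  have hzero : K (Δ⁻¹ • latticePt (h + Pi.single l m)) = 0 := by
    by_contra hne
    have h1 := (kernel_pos_iff hΔ _).1 (lt_of_le_of_ne (hK.nonneg _) (Ne.symm hne))
    have h2 := abs_lt_of_mem_grid_sub_grid (hsupp _ h1) l
    simp only [Pi.add_apply, Pi.single_eq_same] at h2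
    omega
  have hmv := abs_sub_le_of_lineDeriv_le (g := K) (v := EuclideanSpace.single l 1)
    (fun x => hKr.exists_partial [] (by simp) l x) (Δ⁻¹ • latticePt h) (Δ⁻¹ * m)
    (fun σ _ => hB l _)
  rw [mul_smul, ← smul_add, ← latticePt_update_add, hzero, zero_sub, abs_neg, abs_of_nonneg hK0,
    abs_mul, abs_of_pos (inv_pos.2 hΔ), hm1] at hmv
  have h3 : K (Δ⁻¹ • latticePt h) * Δ ≤ B * (N l - |(h l : ℝ)|) := by
    calc K (Δ⁻¹ • latticePt h) * Δ ≤ (B * (Δ⁻¹ * (N l - |(h l : ℝ)|))) * Δ := by gcongr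
      _ = B * (N l - |(h l : ℝ)|) := by field_simp
  calc K (Δ⁻¹ • latticePt h) * N l ≤ K (Δ⁻¹ • latticePt h) * (2 * (R * Δ)) := by
        gcongr
        linarith
    _ = 2 * R * (K (Δ⁻¹ • latticePt h) * Δ) := by ring
    _ ≤ 2 * R * (B * (N l - |(h l : ℝ)|)) := by gcongr
    _ ≤ _ := by nlinarith

end KernelLemmas

section Lags

/-! ### Sums over pairs of grid points -/

variable {d : ℕ}

theorem overlap_eq_prod {N : Fin d → ℕ} {h : Fin d → ℤ} (hh : h ∈ grid N - grid N) :
    overlap N h = ∏ l, ((N l : ℝ) - |(h l : ℝ)|) := by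
  have hset : region N ∩ {x | x + (fun i => (h i : ℝ)) ∈ region N}
      = Set.Icc (fun i => max 0 (-(h i : ℝ))) (fun i => min (N i : ℝ) (N i - h i)) := by
    ext x
    simp only [region, Set.mem_inter_iff, Set.mem_Icc, Set.mem_ofPred_eq, Pi.le_def, Pi.add_apply,
      Pi.zero_apply, max_le_iff, le_min_iff, forall_and]
    constructor
    · rintro ⟨⟨h1, h2⟩, h3, h4⟩
      exact ⟨⟨h1, fun i => by linarith [h3 i]⟩, h2, fun i => by linarith [h4 i]⟩
    · rintro ⟨⟨h1, h2⟩, h3, h4⟩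
      exact ⟨⟨h1, h3⟩, fun i => by linarith [h2 i], fun i => by linarith [h4 i]⟩
  have hlt : ∀ l, |(h l : ℝ)| < N l := fun l => by
    exact_mod_cast abs_lt_of_mem_grid_sub_grid hh l
  have hval : ∀ l, min (N l : ℝ) (N l - h l) - max 0 (-(h l : ℝ)) = N l - |(h l : ℝ)| := by
    intro l
    rcases le_total 0 (h l : ℝ) with hs | hs
    · rw [abs_of_nonneg hs, min_eq_right (by linarith), max_eq_left (by linarith)]
      ring
    · rw [abs_of_nonpos hs, min_eq_left (by linarith), max_eq_right (by linarith)]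
  rw [overlap, hset, Real.volume_Icc_pi_toReal]
  · exact Finset.prod_congr rfl fun l _ => hval l
  · intro l
    have h1 := hval l
    have h2 := hlt l
    beta_reduce
    linarith

theorem overlap_pos {N : Fin d → ℕ} {h : Fin d → ℤ} (hh : h ∈ grid N - grid N) :
    0 < overlap N h := by
  rw [overlap_eq_prod hh]
  refine Finset.prod_pos fun l _ => ?_
  have : |(h l : ℝ)| < N l := by exact_mod_cast abs_lt_of_mem_grid_sub_grid hh l
  linarith

theorem card_grid (N : Fin d → ℕ) : (grid N).card = ∏ l, N l := by
  rw [grid, Pi.card_Icc]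
  simp

/-- This exact agreement of a count with a volume is why the normalisation leaves no edge effect in
the mean of the estimator. -/
theorem card_pairs_with_lag {N : Fin d → ℕ} {h : Fin d → ℤ} (hh : h ∈ grid N - grid N) :
    (({p ∈ grid N ×ˢ grid N | p.1 - p.2 = h} : Finset _).card : ℝ) = overlap N h := by
  have h1 : ({p ∈ grid N ×ˢ grid N | p.1 - p.2 = h} : Finset _).card
      = (Finset.Icc (fun i => max 1 (1 + h i)) (fun i => min (N i : ℤ) (N i + h i))).card := by
    refine Finset.card_bij (fun p _ => p.1) ?_ ?_ ?_
    · rintro ⟨t, s⟩ hp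
      simp only [Finset.mem_filter, Finset.mem_product, grid, Finset.mem_Icc, Pi.le_def,
        Pi.one_apply] at hp ⊢
      obtain ⟨⟨⟨h1, h2⟩, h3, h4⟩, rfl⟩ := hp
      refine ⟨fun i => max_le (h1 i) ?_, fun i => le_min (h2 i) ?_⟩
      · have := h3 i
        simp only [Pi.sub_apply]
        omega
      · have := h4 i
        simp only [Pi.sub_apply]
        omega
    · rintro ⟨t, s⟩ hp ⟨t', s'⟩ hp' rfl
      have e1 := (Finset.mem_filter.1 hp).2
      have e2 := (Finset.mem_filter.1 hp').2
      simp only at e1 e2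
      rw [← e2] at e1
      simpa using e1
    · intro t ht
      simp only [Finset.mem_Icc, Pi.le_def, max_le_iff, le_min_iff] at ht
      refine ⟨(t, t - h), ?_, rfl⟩
      simp only [Finset.mem_filter, Finset.mem_product, grid, Finset.mem_Icc, Pi.le_def,
        Pi.one_apply, Pi.sub_apply, sub_sub_cancel, and_true]
      refine ⟨⟨fun i => (ht.1 i).1, fun i => (ht.2 i).1⟩, fun i => ?_, fun i => ?_⟩
      · have := (ht.1 i).2
        omega
      · have := (ht.2 i).2
        omega
  rw [h1, Pi.card_Icc, overlap_eq_prod hh, Nat.cast_prod]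
  refine Finset.prod_congr rfl fun l _ => ?_
  have hlt := abs_lt_of_mem_grid_sub_grid hh l
  rw [Int.card_Icc]
  have h2 : min (N l : ℤ) (N l + h l) + 1 - max 1 (1 + h l) = N l - |h l| := by
    rcases le_total 0 (h l) with hs | hs
    · rw [abs_of_nonneg hs, min_eq_left (by linarith), max_eq_right (by linarith)]
      ring
    · rw [abs_of_nonpos hs, min_eq_right (by linarith), max_eq_left (by linarith)]
      ring
  rw [h2]
  have h3 : ((((N l : ℤ) - |h l|).toNat : ℤ) : ℝ) = (((N l : ℤ) - |h l| : ℤ) : ℝ) := by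
    rw [Int.toNat_of_nonneg (by linarith)]
  push_cast at h3
  exact h3

theorem sum_grid_sub {E : Type*} [AddCommGroup E] [Module ℝ E] (N : Fin d → ℕ)
    (φ : (Fin d → ℤ) → E) :
    ∑ t ∈ grid N, ∑ s ∈ grid N, φ (t - s) = ∑ h ∈ grid N - grid N, overlap N h • φ h := by
  rw [← Finset.sum_product', ← Finset.sum_fiberwise_of_maps_to
    (t := grid N - grid N) (g := fun p : (Fin d → ℤ) × (Fin d → ℤ) => p.1 - p.2)]
  · refine Finset.sum_congr rfl fun h hh => ?_
    rw [← card_pairs_with_lag hh, Nat.cast_smul_eq_nsmul, ← Finset.sum_const]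
    exact Finset.sum_congr rfl fun p hp => by rw [(Finset.mem_filter.1 hp).2]
  · rintro ⟨t, s⟩ hp
    rw [Finset.mem_product] at hp
    exact Finset.sub_mem_sub hp.1 hp.2

/-! ### The sum of the squared weights -/

/-- A discrete form of `∫₀ⁿ x^{γ-1} dx = n^γ / γ`; the inductive step is Bernoulli's inequality for
the concave power `γ`. -/
theorem sum_rpow_sub_one_le {γ : ℝ} (hγ : 0 < γ) (hγ1 : γ ≤ 1) (n : ℕ) :
    ∑ m ∈ Finset.range n, ((n : ℝ) - m) ^ (γ - 1) ≤ (n : ℝ) ^ γ / γ := by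
  induction n with
  | zero => simp; positivity
  | succ n ih =>
    rw [Finset.sum_range_succ']
    have hb : (0 : ℝ) < n + 1 := by positivity
    have h1 : (n : ℝ) ^ γ ≤ (n + 1 : ℝ) ^ γ - γ * (n + 1 : ℝ) ^ (γ - 1) := by
      have h2 := rpow_one_add_le_one_add_mul_self (s := -(1 / (n + 1 : ℝ)))
        (by rw [neg_le_neg_iff, div_le_one hb]; linarith [(Nat.cast_nonneg n : (0 : ℝ) ≤ n)])
        hγ.le hγ1
      have h3 : (n : ℝ) = (n + 1) * (1 + -(1 / (n + 1 : ℝ))) := by field_simp; ring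
      have h4 : 0 ≤ 1 + -(1 / (n + 1 : ℝ)) := by
        have : 1 / (n + 1 : ℝ) ≤ 1 := by
          rw [div_le_one hb]; linarith [(Nat.cast_nonneg n : (0 : ℝ) ≤ n)]
        linarith
      calc (n : ℝ) ^ γ = (n + 1 : ℝ) ^ γ * (1 + -(1 / (n + 1 : ℝ))) ^ γ := by
            conv_lhs => rw [h3]
            rw [Real.mul_rpow hb.le h4]
        _ ≤ (n + 1 : ℝ) ^ γ * (1 + γ * -(1 / (n + 1 : ℝ))) := by gcongr
        _ = _ := by
            rw [Real.rpow_sub_one hb.ne']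
            ring
    have h5 : ∑ m ∈ Finset.range n, (((n + 1 : ℕ) : ℝ) - ((m + 1 : ℕ) : ℝ)) ^ (γ - 1)
        = ∑ m ∈ Finset.range n, ((n : ℝ) - m) ^ (γ - 1) :=
      Finset.sum_congr rfl fun m _ => by push_cast; ring_nf
    rw [h5]
    push_cast
    rw [sub_zero]
    rw [le_div_iff₀ hγ] at ih ⊢
    nlinarith

theorem sum_Ioo_natAbs_le (n : ℕ) {f : ℕ → ℝ} (hf : ∀ m, m < n → 0 ≤ f m) :
    ∑ j ∈ Finset.Ioo (-(n : ℤ)) n, f j.natAbs ≤ 2 * ∑ m ∈ Finset.range n, f m := by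
  rw [Finset.sum_comp f Int.natAbs, Finset.mul_sum]
  have hsub : (Finset.Ioo (-(n : ℤ)) n).image Int.natAbs ⊆ Finset.range n := by
    intro m hm
    obtain ⟨j, hj, rfl⟩ := Finset.mem_image.1 hm
    rw [Finset.mem_Ioo] at hj
    rw [Finset.mem_range]
    omega
  have hcard : ∀ m, ({j ∈ Finset.Ioo (-(n : ℤ)) n | j.natAbs = m} : Finset ℤ).card ≤ 2 := by
    intro m
    have : ({j ∈ Finset.Ioo (-(n : ℤ)) n | j.natAbs = m} : Finset ℤ) ⊆ {(m : ℤ), -(m : ℤ)} := by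
      intro j hj
      have := (Finset.mem_filter.1 hj).2
      simp only [Finset.mem_insert, Finset.mem_singleton]
      omega
    exact (Finset.card_le_card this).trans Finset.card_le_two
  refine (Finset.sum_le_sum fun m hm => ?_).trans
    (Finset.sum_le_sum_of_subset_of_nonneg hsub fun m hm _ => ?_)
  · rw [nsmul_eq_mul]
    have := hf m (Finset.mem_range.1 (hsub hm))
    gcongr
    exact_mod_cast hcard m
  · have := hf m (Finset.mem_range.1 hm)
    positivity

/-- If `R Δ < n / 2`, there are `O(Δ)` nonzero terms, each `O(1 / n)`. Otherwise lags may approach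
the edge, but the singularity `(n - |j|)^{γ-1}` is summable because `γ > 0`; the resulting constant
is absorbed using `1 ≤ 2 R Δ / n`. -/
theorem sum_boundary_weight_le {γ R C : ℝ} (hγ : 0 < γ) (hγ1 : γ ≤ 1) (hR : 0 ≤ R) (hC : 0 ≤ C)
    {n : ℕ} (hn : 1 ≤ n) {Δ : ℝ} (hΔ : 1 ≤ Δ) :
    ∑ j ∈ Finset.Ioo (-(n : ℤ)) n,
        (if |(j : ℝ)| ≤ R * Δ then
          (C * ((n : ℝ) - |(j : ℝ)|) / n) ^ γ / ((n : ℝ) - |(j : ℝ)|) else 0)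
      ≤ C ^ γ * (2 * (2 * R + 1) + 4 * R / γ) * (Δ / n) := by
  have hn0 : (0 : ℝ) < n := by exact_mod_cast hn
  have hlt : ∀ j ∈ Finset.Ioo (-(n : ℤ)) n, |(j : ℝ)| < n := by
    intro j hj
    rw [Finset.mem_Ioo] at hj
    exact_mod_cast abs_lt.2 hj
  have hCγ : 0 ≤ C ^ γ := by positivity
  rcases lt_or_ge (R * Δ) (n / 2) with hsmall | hlarge
  · have hterm : ∀ j ∈ Finset.Ioo (-(n : ℤ)) n,
        (if |(j : ℝ)| ≤ R * Δ then
          (C * ((n : ℝ) - |(j : ℝ)|) / n) ^ γ / ((n : ℝ) - |(j : ℝ)|) else 0)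
        ≤ if j ∈ Finset.Icc (-⌊R * Δ⌋) ⌊R * Δ⌋ then C ^ γ * (2 / n) else 0 := by
      intro j hj
      by_cases hjR : |(j : ℝ)| ≤ R * Δ
      · have hmem : j ∈ Finset.Icc (-⌊R * Δ⌋) ⌊R * Δ⌋ := by
          rw [Finset.mem_Icc, ← abs_le, Int.le_floor]
          exact_mod_cast hjR
        rw [if_pos hjR, if_pos hmem, div_eq_mul_inv]
        have ha : (n : ℝ) / 2 ≤ n - |(j : ℝ)| := by linarith
        have ha0 : (0 : ℝ) < n - |(j : ℝ)| := by linarith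
        gcongr
        · rw [mul_div_assoc]
          refine mul_le_of_le_one_right hC ?_
          rw [div_le_one hn0]
          linarith [abs_nonneg (j : ℝ)]
        · rw [inv_le_comm₀ ha0 (by positivity), inv_div]
          exact ha
      · rw [if_neg hjR]
        split_ifs <;> positivity
    refine (Finset.sum_le_sum hterm).trans ?_
    rw [← Finset.sum_filter, Finset.sum_const, nsmul_eq_mul]
    have hcard : ((({j ∈ Finset.Ioo (-(n : ℤ)) n | j ∈ Finset.Icc (-⌊R * Δ⌋) ⌊R * Δ⌋} :
        Finset ℤ).card : ℕ) : ℝ) ≤ (2 * R + 1) * Δ := by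
      have h1 : ({j ∈ Finset.Ioo (-(n : ℤ)) n | j ∈ Finset.Icc (-⌊R * Δ⌋) ⌊R * Δ⌋} :
          Finset ℤ).card ≤ (Finset.Icc (-⌊R * Δ⌋) ⌊R * Δ⌋).card :=
        Finset.card_le_card fun j hj => (Finset.mem_filter.1 hj).2
      have h0 : 0 ≤ ⌊R * Δ⌋ := Int.floor_nonneg.2 (by positivity)
      rw [Int.card_Icc] at h1
      have h2 : (((⌊R * Δ⌋ + 1 - -⌊R * Δ⌋).toNat : ℤ) : ℝ) = 2 * ⌊R * Δ⌋ + 1 := by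
        rw [Int.toNat_of_nonneg (by omega)]
        push_cast
        ring
      have h3 : (((⌊R * Δ⌋ + 1 - -⌊R * Δ⌋).toNat : ℕ) : ℝ) = 2 * ⌊R * Δ⌋ + 1 := by
        exact_mod_cast h2
      calc _ ≤ (((⌊R * Δ⌋ + 1 - -⌊R * Δ⌋).toNat : ℕ) : ℝ) := by exact_mod_cast h1
        _ = 2 * ⌊R * Δ⌋ + 1 := h3
        _ ≤ 2 * (R * Δ) + 1 := by gcongr; exact Int.floor_le _
        _ ≤ _ := by nlinarith
    calc _ ≤ (2 * R + 1) * Δ * (C ^ γ * (2 / n)) := by gcongr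
      _ = C ^ γ * (2 * (2 * R + 1)) * (Δ / n) := by ring
      _ ≤ _ := by
          gcongr
          linarith [(by positivity : 0 ≤ 4 * R / γ)]
  · have hterm : ∀ j ∈ Finset.Ioo (-(n : ℤ)) n,
        (if |(j : ℝ)| ≤ R * Δ then
          (C * ((n : ℝ) - |(j : ℝ)|) / n) ^ γ / ((n : ℝ) - |(j : ℝ)|) else 0)
        ≤ C ^ γ / (n : ℝ) ^ γ * ((n : ℝ) - (j.natAbs : ℝ)) ^ (γ - 1) := by
      intro j hj
      have ha0 : (0 : ℝ) < n - |(j : ℝ)| := by linarith [hlt j hj]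
      have hcast : ((j.natAbs : ℕ) : ℝ) = |(j : ℝ)| := by
        rw [Nat.cast_natAbs]
        push_cast
        rfl
      rw [hcast]
      split_ifs
      · rw [Real.div_rpow (by positivity) hn0.le, Real.mul_rpow hC ha0.le,
          Real.rpow_sub_one ha0.ne']
        apply le_of_eq
        ring
      · positivity
    refine (Finset.sum_le_sum hterm).trans ?_
    have h1 := sum_Ioo_natAbs_le n (f := fun m => C ^ γ / (n : ℝ) ^ γ * ((n : ℝ) - m) ^ (γ - 1))
      (fun m hm => by
        have : (0 : ℝ) < n - m := by
          have : (m : ℝ) < n := by exact_mod_cast hm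
          linarith
        positivity)
    refine h1.trans ?_
    rw [← Finset.mul_sum]
    have h2 := sum_rpow_sub_one_le hγ hγ1 n
    have hnγ : (0 : ℝ) < (n : ℝ) ^ γ := by positivity
    calc 2 * (C ^ γ / (n : ℝ) ^ γ * ∑ m ∈ Finset.range n, ((n : ℝ) - m) ^ (γ - 1))
        ≤ 2 * (C ^ γ / (n : ℝ) ^ γ * ((n : ℝ) ^ γ / γ)) := by gcongr
      _ = C ^ γ * (2 / γ) * 1 := by field_simp
      _ ≤ C ^ γ * (2 / γ) * (2 * (R * Δ) / n) := by
          gcongr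
          rw [le_div_iff₀ hn0]
          linarith
      _ = C ^ γ * (4 * R / γ) * (Δ / n) := by ring
      _ ≤ _ := by
          gcongr
          linarith [(by positivity : 0 ≤ 2 * (2 * R + 1))]

/-- The linear decay of `K` holds in each coordinate separately, whereas `overlap` may be small in
all of them at once. Writing `K² ≤ K = ∏ K^{1/d}` spends a power `1/d` of the decay on each
coordinate, which weakens every factor `1 / (N l - |h l|)` enough to be summable and makes the sum a
product. -/
theorem exists_sum_sq_div_overlap_le (hd : 1 ≤ d) {K : EuclideanSpace ℝ (Fin d) → ℝ}
    (hK : IsKernel K) {r : ℕ} (hKr : IsFlatToOrder K r) :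
    ∃ C : ℝ, 0 ≤ C ∧ ∀ (N : Fin d → ℕ) (Δ : ℝ), 1 ≤ Δ → (∀ l, 1 ≤ N l) →
      (∀ k : Fin d → ℤ, latticePt k ∈ Δ • kernelSupport K → k ∈ grid N - grid N) →
      ∑ h ∈ grid N - grid N, K (Δ⁻¹ • latticePt h) ^ 2 / overlap N h
        ≤ C * (Δ ^ d / ((grid N).card : ℝ)) := by
  obtain ⟨R, C, hR, hC, hzero, hbound⟩ := exists_kernel_mul_le hK hKr
  set γ : ℝ := 1 / d with hγdef
  have hd0 : (0 : ℝ) < d := by exact_mod_cast hd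
  have hγ : 0 < γ := by positivity
  have hγ1 : γ ≤ 1 := by
    rw [hγdef, div_le_one hd0]
    exact_mod_cast hd
  set c := C ^ γ * (2 * (2 * R + 1) + 4 * R / γ) with hc
  refine ⟨c ^ d, by positivity, fun N Δ hΔ hN hsupp => ?_⟩
  have hΔ0 : 0 < Δ := by linarith
  set ψ : Fin d → ℤ → ℝ := fun l j => if |(j : ℝ)| ≤ R * Δ then
    (C * ((N l : ℝ) - |(j : ℝ)|) / N l) ^ γ / ((N l : ℝ) - |(j : ℝ)|) else 0 with hψ
  have hψ0 : ∀ l j, j ∈ Finset.Ioo (-(N l : ℤ)) (N l) → 0 ≤ ψ l j := by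
    intro l j hj
    rw [Finset.mem_Ioo] at hj
    have : |(j : ℝ)| < N l := by exact_mod_cast abs_lt.2 hj
    have h2 : (0 : ℝ) < N l - |(j : ℝ)| := by linarith
    simp only [hψ]
    split_ifs <;> positivity
  have hterm : ∀ h ∈ grid N - grid N,
      K (Δ⁻¹ • latticePt h) ^ 2 / overlap N h ≤ ∏ l, ψ l (h l) := by
    intro h hh
    have hlt := abs_lt_of_mem_grid_sub_grid hh
    have hprod0 : 0 ≤ ∏ l, ψ l (h l) := Finset.prod_nonneg fun l _ =>
      hψ0 l _ (by rw [Finset.mem_Ioo]; exact abs_lt.1 (hlt l))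
    have hK0 := hK.nonneg (Δ⁻¹ • latticePt h)
    by_cases hKz : K (Δ⁻¹ • latticePt h) = 0
    · rw [hKz]
      simpa using hprod0
    have hnorm : ‖Δ⁻¹ • latticePt h‖ ≤ R := by
      by_contra hcon
      exact hKz (hzero _ (not_le.1 hcon))
    have hΔR : ∀ l, |(h l : ℝ)| ≤ R * Δ := by
      intro l
      have h1 := (abs_coord_le_norm (Δ⁻¹ • latticePt h) l).trans hnorm
      have h2 : (Δ⁻¹ • latticePt h) l = Δ⁻¹ * h l := by simp [latticePt]
      rw [h2, abs_mul, abs_of_pos (inv_pos.2 hΔ0), inv_mul_le_iff₀ hΔ0] at h1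
      linarith
    have hval : ∏ l, ψ l (h l)
        = (∏ l, (C * ((N l : ℝ) - |(h l : ℝ)|) / N l) ^ γ) / overlap N h := by
      rw [overlap_eq_prod hh, ← Finset.prod_div_distrib]
      exact Finset.prod_congr rfl fun l _ => if_pos (hΔR l)
    rw [hval]
    refine div_le_div_of_nonneg_right ?_ (overlap_pos hh).le
    calc K (Δ⁻¹ • latticePt h) ^ 2 ≤ K (Δ⁻¹ • latticePt h) :=
          pow_le_of_le_one hK0 (hK.le_one _) two_ne_zero
      _ = ∏ _l : Fin d, K (Δ⁻¹ • latticePt h) ^ γ := by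
          rw [Finset.prod_const, Finset.card_univ, Fintype.card_fin, ← Real.rpow_mul_natCast hK0,
            hγdef, one_div_mul_cancel hd0.ne', Real.rpow_one]
      _ ≤ _ := by
          refine Finset.prod_le_prod (fun l _ => by positivity) fun l _ => ?_
          refine Real.rpow_le_rpow hK0 ?_ hγ.le
          rw [le_div_iff₀ (by exact_mod_cast hN l)]
          exact hbound N Δ hΔ0 hsupp h hh l
  have hsub : grid N - grid N ⊆ Fintype.piFinset fun l => Finset.Ioo (-(N l : ℤ)) (N l) := by
    intro h hh
    rw [Fintype.mem_piFinset]
    intro l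
    rw [Finset.mem_Ioo]
    exact abs_lt.1 (abs_lt_of_mem_grid_sub_grid hh l)
  calc ∑ h ∈ grid N - grid N, K (Δ⁻¹ • latticePt h) ^ 2 / overlap N h
      ≤ ∑ h ∈ grid N - grid N, ∏ l, ψ l (h l) := Finset.sum_le_sum hterm
    _ ≤ ∑ h ∈ Fintype.piFinset fun l => Finset.Ioo (-(N l : ℤ)) (N l), ∏ l, ψ l (h l) := by
        refine Finset.sum_le_sum_of_subset_of_nonneg hsub fun h hh _ => ?_
        exact Finset.prod_nonneg fun l _ => hψ0 l _ (Fintype.mem_piFinset.1 hh l)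
    _ = ∏ l, ∑ j ∈ Finset.Ioo (-(N l : ℤ)) (N l), ψ l j := Finset.prod_univ_sum _ _ |>.symm
    _ ≤ ∏ l, (c * (Δ / N l)) := by
        refine Finset.prod_le_prod (fun l _ => Finset.sum_nonneg (hψ0 l)) fun l _ => ?_
        exact sum_boundary_weight_le hγ hγ1 hR hC (hN l) hΔ
    _ = _ := by
        rw [card_grid, Finset.prod_mul_distrib, Finset.prod_div_distrib]
        simp

end Lags

section HilbertVariance

/-! ### Second moments of linear combinations in a Hilbert space -/

variable {V : Type*} [NormedAddCommGroup V] [InnerProductSpace ℂ V] [NormedSpace ℝ V]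
  [CompleteSpace V]
variable {Ω : Type*} [MeasurableSpace Ω] {P : Measure Ω}

theorem integrable_inner_of_memLp_two {Y Z : Ω → V} (hY : MemLp Y 2 P) (hZ : MemLp Z 2 P) :
    Integrable (fun ω => (inner ℂ (Y ω) (Z ω) : ℂ)) P := by
  refine Integrable.mono' (g := fun ω => ‖Y ω‖ ^ 2 + ‖Z ω‖ ^ 2)
    ((hY.integrable_norm_pow two_ne_zero).add (hZ.integrable_norm_pow two_ne_zero))
    (hY.1.inner hZ.1) (Eventually.of_forall fun ω => ?_)
  refine (norm_inner_le_norm _ _).trans ?_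
  nlinarith [sq_nonneg (‖Y ω‖ - ‖Z ω‖), sq_nonneg (‖Y ω‖), sq_nonneg (‖Z ω‖)]

/-- The scalar covariance of two random vectors. -/
def scalarCov (P : Measure Ω) (Y Z : Ω → V) : ℂ :=
  (∫ ω, inner ℂ (Y ω) (Z ω) ∂P) - inner ℂ (∫ ω, Y ω ∂P) (∫ ω, Z ω ∂P)

theorem conj_scalarCov (Y Z : Ω → V) :
    (starRingEnd ℂ) (scalarCov P Y Z) = scalarCov P Z Y := by
  simp only [scalarCov, map_sub, ← integral_conj, inner_conj_symm]

theorem norm_scalarCov_comm (Y Z : Ω → V) : ‖scalarCov P Y Z‖ = ‖scalarCov P Z Y‖ := by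
  rw [← conj_scalarCov, RCLike.norm_conj]

variable [IsProbabilityMeasure P]

theorem integral_inner_sub_mean {Y Z : Ω → V} (hY : MemLp Y 2 P) (hZ : MemLp Z 2 P) :
    ∫ ω, inner ℂ (Y ω - ∫ ω', Y ω' ∂P) (Z ω - ∫ ω', Z ω' ∂P) ∂P = scalarCov P Y Z := by
  have hY1 := hY.integrable one_le_two
  have hZ1 := hZ.integrable one_le_two
  set a := ∫ ω', Y ω' ∂P with ha
  set b := ∫ ω', Z ω' ∂P with hb
  have h1 : ∫ ω, inner ℂ a (Z ω) ∂P = inner ℂ a b := integral_inner hZ1 a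
  have h2 : ∫ ω, inner ℂ (Y ω) b ∂P = inner ℂ a b := by
    rw [← inner_conj_symm, ha, ← integral_inner (𝕜 := ℂ) hY1 b, ← integral_conj]
    simp only [inner_conj_symm]
  simp only [inner_sub_left, inner_sub_right]
  rw [integral_sub, integral_sub, integral_sub, h1, h2]
  · simp [scalarCov, ← ha, ← hb]
  · exact hY1.inner_const b
  · exact integrable_const _
  · exact integrable_inner_of_memLp_two hY hZ
  · exact hZ1.const_inner a
  · exact (integrable_inner_of_memLp_two hY hZ).sub (hZ1.const_inner a)
  · exact (hY1.inner_const b).sub (integrable_const _)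

/-- Schur's test: the square is expanded, `‖c i‖ ‖c j‖` is bounded by half the sum of squares, and
Hermitian symmetry makes row and column sums of the covariances agree. -/
theorem integral_norm_sq_sum_le {I : Type*} (s : Finset I) {W : I → Ω → V}
    (hW : ∀ i ∈ s, MemLp (W i) 2 P) (c : I → ℂ) {Λ : ℝ}
    (hΛ : ∀ i ∈ s, ∑ j ∈ s, ‖scalarCov P (W j) (W i)‖ ≤ Λ) :
    ∫ ω, ‖∑ i ∈ s, c i • (W i ω - ∫ ω', W i ω' ∂P)‖ ^ 2 ∂P ≤ Λ * ∑ i ∈ s, ‖c i‖ ^ 2 := by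
  have hWc : ∀ i ∈ s, MemLp (fun ω => W i ω - ∫ ω', W i ω' ∂P) 2 P := fun i hi =>
    (hW i hi).sub (memLp_const _)
  have h1 : ((∫ ω, ‖∑ i ∈ s, c i • (W i ω - ∫ ω', W i ω' ∂P)‖ ^ 2 ∂P : ℝ) : ℂ)
      = ∑ i ∈ s, ∑ j ∈ s, (starRingEnd ℂ) (c i) * c j * scalarCov P (W i) (W j) := by
    rw [← integral_complex_ofReal]
    have h2 : ∀ ω, ((‖∑ i ∈ s, c i • (W i ω - ∫ ω', W i ω' ∂P)‖ ^ 2 : ℝ) : ℂ)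
        = ∑ i ∈ s, ∑ j ∈ s, (starRingEnd ℂ) (c i) * c j *
          inner ℂ (W i ω - ∫ ω', W i ω' ∂P) (W j ω - ∫ ω', W j ω' ∂P) := by
      intro ω
      push_cast
      rw [← Complex.coe_algebraMap, ← inner_self_eq_norm_sq_to_K (𝕜 := ℂ), sum_inner]
      refine Finset.sum_congr rfl fun i _ => ?_
      rw [inner_sum]
      refine Finset.sum_congr rfl fun j _ => ?_
      rw [inner_smul_left, inner_smul_right, mul_assoc]
    simp_rw [h2]
    have hint : ∀ i ∈ s, ∀ j ∈ s, Integrable (fun ω => (starRingEnd ℂ) (c i) * c j *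
        inner ℂ (W i ω - ∫ ω', W i ω' ∂P) (W j ω - ∫ ω', W j ω' ∂P)) P := fun i hi j hj =>
      (integrable_inner_of_memLp_two (hWc i hi) (hWc j hj)).const_mul _
    rw [integral_finsetSum _ fun i hi => integrable_finsetSum _ (hint i hi)]
    refine Finset.sum_congr rfl fun i hi => ?_
    rw [integral_finsetSum _ (hint i hi)]
    refine Finset.sum_congr rfl fun j hj => ?_
    rw [integral_const_mul, integral_inner_sub_mean (hW i hi) (hW j hj)]
  have h3 : ∫ ω, ‖∑ i ∈ s, c i • (W i ω - ∫ ω', W i ω' ∂P)‖ ^ 2 ∂P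
      ≤ ∑ i ∈ s, ∑ j ∈ s, ‖c i‖ * ‖c j‖ * ‖scalarCov P (W i) (W j)‖ := by
    refine (le_abs_self _).trans ?_
    rw [← Real.norm_eq_abs, ← Complex.norm_real, h1]
    refine (norm_sum_le _ _).trans (Finset.sum_le_sum fun i _ => ?_)
    refine (norm_sum_le _ _).trans (Finset.sum_le_sum fun j _ => ?_)
    rw [norm_mul, norm_mul, RCLike.norm_conj]
  have h4 : ∑ i ∈ s, ∑ j ∈ s, ‖c i‖ ^ 2 * ‖scalarCov P (W i) (W j)‖ ≤ Λ * ∑ i ∈ s, ‖c i‖ ^ 2 := by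
    rw [Finset.mul_sum]
    refine Finset.sum_le_sum fun i hi => ?_
    rw [← Finset.mul_sum, mul_comm]
    gcongr
    refine le_trans (le_of_eq ?_) (hΛ i hi)
    exact Finset.sum_congr rfl fun j _ => norm_scalarCov_comm _ _
  have h5 : ∑ i ∈ s, ∑ j ∈ s, ‖c j‖ ^ 2 * ‖scalarCov P (W i) (W j)‖ ≤ Λ * ∑ i ∈ s, ‖c i‖ ^ 2 := by
    rw [Finset.sum_comm, Finset.mul_sum]
    refine Finset.sum_le_sum fun i hi => ?_
    rw [← Finset.mul_sum, mul_comm]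
    gcongr
    exact hΛ i hi
  have h6 : ∑ i ∈ s, ∑ j ∈ s, ‖c i‖ * ‖c j‖ * ‖scalarCov P (W i) (W j)‖
      ≤ (∑ i ∈ s, ∑ j ∈ s, ‖c i‖ ^ 2 * ‖scalarCov P (W i) (W j)‖
        + ∑ i ∈ s, ∑ j ∈ s, ‖c j‖ ^ 2 * ‖scalarCov P (W i) (W j)‖) / 2 := by
    rw [← Finset.sum_add_distrib, Finset.sum_div]
    refine Finset.sum_le_sum fun i _ => ?_
    rw [← Finset.sum_add_distrib, Finset.sum_div]
    refine Finset.sum_le_sum fun j _ => ?_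
    nlinarith [mul_nonneg (norm_nonneg (scalarCov P (W i) (W j))) (sq_nonneg (‖c i‖ - ‖c j‖))]
  linarith

end HilbertVariance

section Moments

/-! ### Moments of a random field -/

variable {H : Type*} [NormedAddCommGroup H] [InnerProductSpace ℂ H] [CompleteSpace H]
variable {ι : Type*} {Ω : Type*} [MeasurableSpace Ω] {P : Measure Ω}

theorem continuous_sesquilinear {G : Type*} [NormedAddCommGroup G] [NormedSpace ℂ G]
    (f : H →L[ℂ] H →L⋆[ℂ] G) : Continuous fun p : H × H => f p.1 p.2 := by
  rw [continuous_iff_continuousAt]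
  rintro ⟨x, y⟩
  rw [ContinuousAt, tendsto_iff_norm_sub_tendsto_zero]
  have hlim : Tendsto (fun p : H × H => ‖f‖ * ‖p.1 - x‖ * ‖p.2‖ + ‖f x‖ * ‖p.2 - y‖)
      (𝓝 (x, y)) (𝓝 (‖f‖ * ‖x - x‖ * ‖y‖ + ‖f x‖ * ‖y - y‖)) :=
    Continuous.tendsto (by fun_prop) (x, y)
  simp only [sub_self, norm_zero, mul_zero, zero_mul, add_zero] at hlim
  refine squeeze_zero (fun _ => norm_nonneg _) (fun p => ?_) hlim
  have h : f p.1 p.2 - f x y = f (p.1 - x) p.2 + f x (p.2 - y) := by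
    rw [map_sub, map_sub, sub_apply]
    abel
  rw [h]
  refine (norm_add_le _ _).trans (add_le_add ?_ ((f x).le_opNorm _))
  exact ((f (p.1 - x)).le_opNorm _).trans (by gcongr; exact f.le_opNorm _)

theorem aestronglyMeasurable_hsRankOne (e : HilbertBasis ι ℂ H) {Y Z : Ω → H}
    (hY : AEStronglyMeasurable Y P) (hZ : AEStronglyMeasurable Z P) :
    AEStronglyMeasurable (fun ω => hsRankOne e (Y ω) (Z ω)) P :=
  (continuous_sesquilinear (hsRankOne e)).comp_aestronglyMeasurable (hY.prodMk hZ)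

theorem integrable_hsRankOne (e : HilbertBasis ι ℂ H) {Y Z : Ω → H} (hY : MemLp Y 2 P)
    (hZ : MemLp Z 2 P) : Integrable (fun ω => hsRankOne e (Y ω) (Z ω)) P := by
  refine Integrable.mono' (g := fun ω => ‖Y ω‖ ^ 2 + ‖Z ω‖ ^ 2)
    ((hY.integrable_norm_pow two_ne_zero).add (hZ.integrable_norm_pow two_ne_zero))
    (aestronglyMeasurable_hsRankOne e hY.1 hZ.1) (Eventually.of_forall fun ω => ?_)
  rw [norm_hsRankOne]
  nlinarith [sq_nonneg (‖Y ω‖ - ‖Z ω‖), sq_nonneg (‖Y ω‖), sq_nonneg (‖Z ω‖)]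

theorem continuous_rankOne :
    Continuous fun p : H × H => (InnerProductSpace.rankOne ℂ p.1 p.2 : H →L[ℂ] H) :=
  continuous_sesquilinear (G := H →L[ℂ] H) (InnerProductSpace.rankOne ℂ (E := H) (F := H))

theorem integrable_rankOne {Y Z : Ω → H} (hY : MemLp Y 2 P) (hZ : MemLp Z 2 P) :
    Integrable (fun ω => InnerProductSpace.rankOne ℂ (Y ω) (Z ω)) P := by
  have hm : AEStronglyMeasurable
      (fun ω => (InnerProductSpace.rankOne ℂ (Y ω) (Z ω) : H →L[ℂ] H)) P :=
    Continuous.comp_aestronglyMeasurable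
      (g := fun p : H × H => (InnerProductSpace.rankOne ℂ p.1 p.2 : H →L[ℂ] H))
      (f := fun ω => (Y ω, Z ω)) continuous_rankOne (hY.1.prodMk hZ.1)
  refine Integrable.mono' (g := fun ω => ‖Y ω‖ ^ 2 + ‖Z ω‖ ^ 2)
    ((hY.integrable_norm_pow two_ne_zero).add (hZ.integrable_norm_pow two_ne_zero))
    hm (Eventually.of_forall fun ω => ?_)
  rw [InnerProductSpace.norm_rankOne]
  nlinarith [sq_nonneg (‖Y ω‖ - ‖Z ω‖), sq_nonneg (‖Y ω‖), sq_nonneg (‖Z ω‖)]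

theorem memLp_hsRankOne (e : HilbertBasis ι ℂ H) {Y Z : Ω → H} (hY : MemLp Y 4 P)
    (hZ : MemLp Z 4 P) : MemLp (fun ω => hsRankOne e (Y ω) (Z ω)) 2 P := by
  have hm := aestronglyMeasurable_hsRankOne e hY.1 hZ.1
  have h4Y : Integrable (fun ω => ‖Y ω‖ ^ 4) P :=
    MemLp.integrable_norm_pow (p := 4) (by exact_mod_cast hY) (by norm_num)
  have h4Z : Integrable (fun ω => ‖Z ω‖ ^ 4) P :=
    MemLp.integrable_norm_pow (p := 4) (by exact_mod_cast hZ) (by norm_num)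
  rw [← memLp_norm_iff hm]
  refine (memLp_two_iff_integrable_sq hm.norm).2 ?_
  refine Integrable.mono' (h4Y.add h4Z) (hm.norm.pow 2) (Eventually.of_forall fun ω => ?_)
  rw [norm_hsRankOne, Real.norm_of_nonneg (by positivity), Pi.add_apply]
  nlinarith [sq_nonneg (‖Y ω‖ ^ 2 - ‖Z ω‖ ^ 2), sq_nonneg (‖Y ω‖ ^ 2), sq_nonneg (‖Z ω‖ ^ 2)]

theorem representsHS_covOp (e : HilbertBasis ι ℂ H) {Y Z : Ω → H} (hY : MemLp Y 2 P)
    (hZ : MemLp Z 2 P) :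
    RepresentsHS e (covOp P Y Z) (∫ ω, hsRankOne e (Y ω) (Z ω) ∂P) := fun j => by
  rw [← lpEval_apply, ← ContinuousLinearMap.integral_comp_comm _ (integrable_hsRankOne e hY hZ),
    covOp, ContinuousLinearMap.integral_apply (integrable_rankOne hY hZ)]
  exact integral_congr_ae (Eventually.of_forall fun ω => representsHS_hsRankOne e _ _ j)

/-- The left-hand integral is the trace of `E[Z ⊗ Y]`: Parseval's expansion is integrated termwise,
dominated by the squared coefficients of `Y` and `Z`, and the partial sums of the trace are bounded
by the trace norm. -/
theorem norm_integral_inner_le_traceNorm [TopologicalSpace.SeparableSpace H]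
    (e : HilbertBasis ι ℂ H) {Y Z : Ω → H} (hY : MemLp Y 2 P) (hZ : MemLp Z 2 P)
    (hT : traceNorm e (covOp P Z Y) ≠ ∞) :
    ‖∫ ω, (inner ℂ (Y ω) (Z ω) : ℂ) ∂P‖ ≤ (traceNorm e (covOp P Z Y)).toReal := by
  have := countable_of_hilbertBasis e
  have hsum : HasSum (fun j => ∫ ω, inner ℂ (Y ω) (e j) * inner ℂ (e j) (Z ω) ∂P)
      (∫ ω, (inner ℂ (Y ω) (Z ω) : ℂ) ∂P) := by
    have hbs : ∀ ω, HasSum (fun j => ‖inner ℂ (e j) (Y ω)‖ ^ 2 + ‖inner ℂ (e j) (Z ω)‖ ^ 2)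
        (‖Y ω‖ ^ 2 + ‖Z ω‖ ^ 2) := fun ω =>
      (hasSum_norm_inner_sq e (Y ω)).add (hasSum_norm_inner_sq e (Z ω))
    refine hasSum_integral_of_dominated_convergence
      (fun j ω => ‖inner ℂ (e j) (Y ω)‖ ^ 2 + ‖inner ℂ (e j) (Z ω)‖ ^ 2) (fun j => ?_)
      (fun j => Eventually.of_forall fun ω => ?_)
      (Eventually.of_forall fun ω => (hbs ω).summable) ?_
      (Eventually.of_forall fun ω => e.hasSum_inner_mul_inner _ _)
    · exact (hY.1.inner aestronglyMeasurable_const).mul (aestronglyMeasurable_const.inner hZ.1)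
    · rw [norm_mul, norm_inner_symm]
      nlinarith [sq_nonneg (‖(inner ℂ (e j) (Y ω) : ℂ)‖ - ‖(inner ℂ (e j) (Z ω) : ℂ)‖),
        sq_nonneg ‖(inner ℂ (e j) (Y ω) : ℂ)‖, sq_nonneg ‖(inner ℂ (e j) (Z ω) : ℂ)‖]
    · simp_rw [fun ω => (hbs ω).tsum_eq]
      exact (hY.integrable_norm_pow two_ne_zero).add (hZ.integrable_norm_pow two_ne_zero)
  have hterm : ∀ j, ∫ ω, inner ℂ (Y ω) (e j) * inner ℂ (e j) (Z ω) ∂P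
      = inner ℂ (e j) (covOp P Z Y (e j)) := by
    intro j
    rw [covOp, ContinuousLinearMap.integral_apply (integrable_rankOne hZ hY),
      ← integral_inner ((integrable_rankOne hZ hY).apply_continuousLinearMap (e j))]
    refine integral_congr_ae (Eventually.of_forall fun ω => ?_)
    simp [inner_smul_right]
  simp_rw [hterm] at hsum
  refine le_of_tendsto (Tendsto.norm hsum) (Eventually.of_forall fun F => ?_)
  exact (norm_sum_le _ _).trans (sum_norm_inner_le_traceNorm e _ hT F)

end Moments

section Bias

/-! ### The bias of a lag-window series -/

variable {d : ℕ}

/-- The coefficient of `X(t) ⊗ X(s)` in the lag-window estimator, as a function of the lag. -/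
def lagWeight (K : EuclideanSpace ℝ (Fin d) → ℝ) (N : Fin d → ℕ) (Δ : ℝ) (θ : Fin d → ℝ)
    (h : Fin d → ℤ) : ℂ :=
  (((2 * Real.pi) ^ d : ℝ) : ℂ)⁻¹ *
    (character h θ * ((K (Δ⁻¹ • latticePt h) / overlap N h : ℝ) : ℂ))

theorem norm_inv_two_pi_pow_le : ‖(((2 * Real.pi) ^ d : ℝ) : ℂ)⁻¹‖ ≤ 1 := by
  rw [norm_inv, Complex.norm_real, Real.norm_of_nonneg (by positivity)]
  refine inv_le_one_of_one_le₀ (one_le_pow₀ ?_)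
  linarith [Real.pi_gt_three]

theorem norm_lagWeight_le {K : EuclideanSpace ℝ (Fin d) → ℝ} (N : Fin d → ℕ) (Δ : ℝ)
    (θ : Fin d → ℝ) (h : Fin d → ℤ) :
    ‖lagWeight K N Δ θ h‖ ≤ |K (Δ⁻¹ • latticePt h) / overlap N h| := by
  rw [lagWeight, norm_mul, norm_mul, norm_character, one_mul, Complex.norm_real, Real.norm_eq_abs]
  exact mul_le_of_le_one_left (abs_nonneg _) norm_inv_two_pi_pow_le

theorem norm_latticePt_smul_rpow {Δ : ℝ} (hΔ : 0 < Δ) (β : ℝ) (k : Fin d → ℤ) :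
    ‖Δ⁻¹ • latticePt k‖ ^ β = Δ ^ (-β) * ‖latticePt k‖ ^ β := by
  rw [norm_smul, norm_inv, Real.norm_of_nonneg hΔ.le,
    Real.mul_rpow (by positivity) (norm_nonneg _), Real.inv_rpow hΔ.le, Real.rpow_neg hΔ.le]

theorem norm_lag_series_sub_le {V : Type*} [NormedAddCommGroup V] [NormedSpace ℂ V]
    [CompleteSpace V] {K : EuclideanSpace ℝ (Fin d) → ℝ} (hK0 : ∀ u, 0 ≤ K u) {β c L : ℝ}
    (hc : 0 ≤ c) (hKβ : ∀ u, |K u - 1| ≤ c * ‖u‖ ^ β) {N : Fin d → ℕ} {Δ : ℝ} (hΔ : 0 < Δ)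
    (hsupp : ∀ k : Fin d → ℤ, latticePt k ∈ Δ • kernelSupport K → k ∈ grid N - grid N)
    {v : (Fin d → ℤ) → V} {g : (Fin d → ℤ) → ℝ} (hvg : ∀ k, ‖v k‖ ≤ g k)
    (hg : Summable fun k => g k * (1 + ‖latticePt k‖ ^ β))
    (hgL : ∑' k, g k * (1 + ‖latticePt k‖ ^ β) ≤ L) (θ : Fin d → ℝ) :
    ‖∑ p ∈ grid N ×ˢ grid N, lagWeight K N Δ θ (p.1 - p.2) • v (p.1 - p.2)
      - (((2 * Real.pi) ^ d : ℝ) : ℂ)⁻¹ • ∑' k, character k θ • v k‖ ≤ c * L * Δ ^ (-β) := by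
  have hg0 : ∀ k, 0 ≤ g k := fun k => (norm_nonneg _).trans (hvg k)
  have hpow0 : ∀ k : Fin d → ℤ, 0 ≤ ‖latticePt k‖ ^ β := fun k => by positivity
  have hvs : Summable fun k => character k θ • v k := by
    refine Summable.of_norm_bounded hg fun k => ?_
    rw [norm_smul, norm_character, one_mul]
    exact (hvg k).trans (le_mul_of_one_le_right (hg0 k) (by linarith [hpow0 k]))
  set w : (Fin d → ℤ) → V :=
    fun k => character k θ • ((K (Δ⁻¹ • latticePt k) : ℝ) : ℂ) • v k with hw
  -- No lag carrying kernel mass lies outside the grid differences, so the finite sum is the whole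
  -- weighted Fourier series.
  have hzero : ∀ k ∉ grid N - grid N, K (Δ⁻¹ • latticePt k) = 0 := by
    intro k hk
    by_contra hne
    exact hk (hsupp k ((kernel_pos_iff hΔ k).1 (lt_of_le_of_ne (hK0 _) (Ne.symm hne))))
  have hws : HasSum w (∑ k ∈ grid N - grid N, w k) :=
    hasSum_sum_of_ne_finset_zero fun k hk => by simp [hw, hzero k hk]
  have h1 : ∑ p ∈ grid N ×ˢ grid N, lagWeight K N Δ θ (p.1 - p.2) • v (p.1 - p.2)
      = (((2 * Real.pi) ^ d : ℝ) : ℂ)⁻¹ • ∑ k ∈ grid N - grid N, w k := by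
    rw [Finset.sum_product, sum_grid_sub N fun h => lagWeight K N Δ θ h • v h, Finset.smul_sum]
    refine Finset.sum_congr rfl fun h hh => ?_
    have hne : ((overlap N h : ℝ) : ℂ) ≠ 0 := by exact_mod_cast (overlap_pos hh).ne'
    rw [RCLike.real_smul_eq_coe_smul (K := ℂ), hw]
    simp only [smul_smul, lagWeight]
    congr 1
    push_cast
    simp only [Complex.coe_algebraMap]
    field_simp
  have h2 := (hws.sub hvs.hasSum)
  rw [h1, ← smul_sub, ← h2.tsum_eq, norm_smul]
  have hterm : ∀ k, ‖w k - character k θ • v k‖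
      ≤ c * Δ ^ (-β) * (g k * (1 + ‖latticePt k‖ ^ β)) := by
    intro k
    have h3 : w k - character k θ • v k
        = character k θ • ((K (Δ⁻¹ • latticePt k) - 1 : ℝ) : ℂ) • v k := by
      simp only [hw, Complex.ofReal_sub, Complex.ofReal_one, sub_smul, one_smul, smul_sub]
    rw [h3, norm_smul, norm_smul, norm_character, one_mul, Complex.norm_real, Real.norm_eq_abs]
    calc |K (Δ⁻¹ • latticePt k) - 1| * ‖v k‖
        ≤ (c * (Δ ^ (-β) * ‖latticePt k‖ ^ β)) * g k := by
          rw [← norm_latticePt_smul_rpow hΔ]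
          gcongr
          · exact hKβ _
          · exact hvg k
      _ = c * Δ ^ (-β) * (g k * ‖latticePt k‖ ^ β) := by ring
      _ ≤ _ := by
          gcongr
          · exact hg0 k
          · linarith
  calc ‖(((2 * Real.pi) ^ d : ℝ) : ℂ)⁻¹‖ * ‖∑' k, (w k - character k θ • v k)‖
      ≤ 1 * ‖∑' k, (w k - character k θ • v k)‖ := by
        gcongr
        exact norm_inv_two_pi_pow_le
    _ = ‖∑' k, (w k - character k θ • v k)‖ := one_mul _
    _ ≤ ∑' k, c * Δ ^ (-β) * (g k * (1 + ‖latticePt k‖ ^ β)) :=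
        tsum_of_norm_bounded (hg.mul_left _).hasSum hterm
    _ = c * Δ ^ (-β) * ∑' k, g k * (1 + ‖latticePt k‖ ^ β) := tsum_mul_left
    _ ≤ c * Δ ^ (-β) * L := by gcongr
    _ = _ := by ring

end Bias

section Field

/-! ### Covariances of a regular random field -/

variable {H : Type*} [NormedAddCommGroup H] [InnerProductSpace ℂ H] [CompleteSpace H]
variable {ι : Type*} {Ω : Type*} [MeasurableSpace Ω] {P : Measure Ω} {d : ℕ}
variable {e : HilbertBasis ι ℂ H} {X : (Fin d → ℤ) → Ω → H}

/-- The trace norm of the autocovariance operator, as a real number. -/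
def covTrace (e : HilbertBasis ι ℂ H) (P : Measure Ω) (X : (Fin d → ℤ) → Ω → H)
    (k : Fin d → ℤ) : ℝ :=
  (traceNorm e (autoCov P X k)).toReal

/-- The square-summable family representing the autocovariance operator. -/
def hsAutoCov (e : HilbertBasis ι ℂ H) (P : Measure Ω) (X : (Fin d → ℤ) → Ω → H)
    (k : Fin d → ℤ) : lp (fun _ : ι => H) 2 :=
  ∫ ω, hsRankOne e (X k ω) (X 0 ω) ∂P

namespace IsRegularField

theorem covOp_eq (hX : IsRegularField e P X) (t s : Fin d → ℤ) :
    covOp P (X t) (X s) = autoCov P X (t - s) := by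
  simpa [autoCov] using hX.stationary.cov_shift (t - s) 0 s

theorem representsHS_hsAutoCov (hX : IsRegularField e P X) (k : Fin d → ℤ) :
    RepresentsHS e (autoCov P X k) (hsAutoCov e P X k) :=
  representsHS_covOp e (hX.stationary.memLp_two k) (hX.stationary.memLp_two 0)

theorem integral_hsRankOne_eq (hX : IsRegularField e P X) (t s : Fin d → ℤ) :
    ∫ ω, hsRankOne e (X t ω) (X s ω) ∂P = hsAutoCov e P X (t - s) := by
  ext j
  rw [hX.representsHS_hsAutoCov (t - s) j, ← hX.covOp_eq]
  exact representsHS_covOp e (hX.stationary.memLp_two t) (hX.stationary.memLp_two s) j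

theorem traceNorm_ne_top (hX : IsRegularField e P X) (k : Fin d → ℤ) :
    traceNorm e (autoCov P X k) ≠ ∞ :=
  ENNReal.ne_top_of_tsum_ne_top hX.summable_cov.ne k

theorem covTrace_nonneg (k : Fin d → ℤ) : 0 ≤ covTrace e P X k := ENNReal.toReal_nonneg

theorem norm_hsAutoCov_le (hX : IsRegularField e P X) (k : Fin d → ℤ) :
    ‖hsAutoCov e P X k‖ ≤ covTrace e P X k := by
  have h1 := hsNorm_le_traceNorm e (autoCov P X k)
  rw [(hX.representsHS_hsAutoCov k).hsNorm_eq] at h1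
  have h2 := ENNReal.toReal_mono (hX.traceNorm_ne_top k) h1
  rwa [toReal_enorm] at h2

theorem summable_norm_autoCov (hX : IsRegularField e P X) :
    Summable fun k => ‖autoCov P X k‖ := by
  refine Summable.of_nonneg_of_le (fun _ => norm_nonneg _) (fun k => ?_)
    (ENNReal.summable_toReal hX.summable_cov.ne)
  have h2 := ENNReal.toReal_mono (hX.traceNorm_ne_top k)
    ((enorm_le_hsNorm e _).trans (hsNorm_le_traceNorm e (autoCov P X k)))
  rwa [toReal_enorm] at h2

theorem tsum_covTrace_of_mem_powerLawClass (hX : IsRegularField e P X) {β L : ℝ} (hL : 0 ≤ L)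
    (hf : spectralDensity P X ∈ powerLawClass e d β L) :
    (Summable fun k => covTrace e P X k * (1 + ‖latticePt k‖ ^ β)) ∧
      ∑' k, covTrace e P X k * (1 + ‖latticePt k‖ ^ β) ≤ L := by
  obtain ⟨C, hC, hCL⟩ := hf
  have hpow0 : ∀ k : Fin d → ℤ, 0 ≤ ‖latticePt k‖ ^ β := fun k => by positivity
  have htop : ∑' k, traceNorm e (C k) * ENNReal.ofReal (1 + ‖latticePt k‖ ^ β) ≠ ∞ :=
    (hCL.trans_lt ENNReal.ofReal_lt_top).ne
  have hle : ∀ k, traceNorm e (C k)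
      ≤ traceNorm e (C k) * ENNReal.ofReal (1 + ‖latticePt k‖ ^ β) := fun k =>
    le_mul_of_one_le_right' (ENNReal.one_le_ofReal.2 (by linarith [hpow0 k]))
  have htop' : ∑' k, traceNorm e (C k) ≠ ∞ :=
    ((ENNReal.tsum_le_tsum hle).trans_lt htop.lt_top).ne
  have hCs : Summable fun k => ‖C k‖ := by
    refine Summable.of_nonneg_of_le (fun _ => norm_nonneg _) (fun k => ?_)
      (ENNReal.summable_toReal htop')
    have h2 := ENNReal.toReal_mono (ENNReal.ne_top_of_tsum_ne_top htop' k)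
      ((enorm_le_hsNorm e _).trans (hsNorm_le_traceNorm e (C k)))
    rwa [toReal_enorm] at h2
  -- The class provides an unspecified coefficient family; uniqueness transfers its weighted bound
  -- to the true autocovariance.
  have hEq : autoCov P X = C := fourierSeries_injOn_summable hX.summable_norm_autoCov hCs hC
  subst hEq
  have hterm : ∀ k, (traceNorm e (autoCov P X k)
      * ENNReal.ofReal (1 + ‖latticePt k‖ ^ β)).toReal
      = covTrace e P X k * (1 + ‖latticePt k‖ ^ β) := fun k => by
    rw [ENNReal.toReal_mul, ENNReal.toReal_ofReal (by linarith [hpow0 k]), covTrace]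
  constructor
  · simpa only [hterm] using ENNReal.summable_toReal htop
  · simp_rw [← hterm]
    rw [← ENNReal.tsum_toReal_eq (ENNReal.ne_top_of_tsum_ne_top htop)]
    exact ENNReal.toReal_le_of_le_ofReal hL hCL

theorem tsum_covTrace_le {β L : ℝ}
    (hg : Summable fun k => covTrace e P X k * (1 + ‖latticePt k‖ ^ β))
    (hgL : ∑' k, covTrace e P X k * (1 + ‖latticePt k‖ ^ β) ≤ L) :
    Summable (covTrace e P X) ∧ ∑' k, covTrace e P X k ≤ L := by
  have hle : ∀ k, covTrace e P X k ≤ covTrace e P X k * (1 + ‖latticePt k‖ ^ β) := fun k =>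
    le_mul_of_one_le_right (covTrace_nonneg k)
      (by linarith [(by positivity : 0 ≤ ‖latticePt k‖ ^ β)])
  have hs := Summable.of_nonneg_of_le covTrace_nonneg hle hg
  exact ⟨hs, (hs.tsum_le_tsum hle hg).trans hgL⟩

/-- The definition of the cumulant solved for the covariance. Reality of the field removes the
conjugations, so the pseudo-covariance is again the autocovariance. -/
theorem scalarCov_eq (hX : IsRegularField e P X) (t s t' s' : Fin d → ℤ) :
    scalarCov P (fun ω => hsRankOne e (X t ω) (X s ω)) (fun ω => hsRankOne e (X t' ω) (X s' ω))
      = cum4 e P (X t) (X s) (X t') (X s')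
        + (∫ ω, inner ℂ (X t ω) (X t' ω) ∂P) * (∫ ω, inner ℂ (X s' ω) (X s ω) ∂P)
        + inner ℂ (hsAutoCov e P X (t - s')) (hsAutoCov e P X (t' - s)) := by
  have hconj : ∀ a b, covOp P (X a) (fun ω => conjVec e (X b ω)) = autoCov P X (a - b) := by
    intro a b
    rw [← hX.covOp_eq]
    refine integral_congr_ae ?_
    filter_upwards [hX.real b] with ω hω
    rw [hω]
  have h1 : ∀ ω, hsInner e (InnerProductSpace.rankOne ℂ (X t ω) (X s ω))
      (InnerProductSpace.rankOne ℂ (X t' ω) (X s' ω))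
      = inner ℂ (hsRankOne e (X t ω) (X s ω)) (hsRankOne e (X t' ω) (X s' ω)) := fun ω =>
    (representsHS_hsRankOne e _ _).hsInner_eq (representsHS_hsRankOne e _ _)
  rw [cum4, hconj, hconj, hX.covOp_eq, hX.covOp_eq, scalarCov, hX.integral_hsRankOne_eq,
    hX.integral_hsRankOne_eq,
    (hX.representsHS_hsAutoCov _).hsInner_eq (hX.representsHS_hsAutoCov _),
    (hX.representsHS_hsAutoCov _).hsInner_eq (hX.representsHS_hsAutoCov _)]
  simp_rw [h1]
  ring

theorem norm_integral_inner_le [TopologicalSpace.SeparableSpace H] (hX : IsRegularField e P X)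
    (t s : Fin d → ℤ) :
    ‖∫ ω, (inner ℂ (X t ω) (X s ω) : ℂ) ∂P‖ ≤ covTrace e P X (s - t) := by
  have := norm_integral_inner_le_traceNorm e (hX.stationary.memLp_two t)
    (hX.stationary.memLp_two s) (by rw [hX.covOp_eq]; exact hX.traceNorm_ne_top _)
  rwa [hX.covOp_eq] at this

theorem norm_scalarCov_le [TopologicalSpace.SeparableSpace H] (hX : IsRegularField e P X)
    (t s t' s' : Fin d → ℤ) :
    ‖scalarCov P (fun ω => hsRankOne e (X t ω) (X s ω)) (fun ω => hsRankOne e (X t' ω) (X s' ω))‖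
      ≤ ‖cum4 e P (X t) (X s) (X t') (X s')‖
        + covTrace e P X (t' - t) * covTrace e P X (s - s')
        + covTrace e P X (t - s') * covTrace e P X (t' - s) := by
  rw [hX.scalarCov_eq]
  refine norm_add₃_le.trans ?_
  rw [norm_mul]
  refine add_le_add (add_le_add le_rfl ?_) ?_
  · exact mul_le_mul (hX.norm_integral_inner_le t t') (hX.norm_integral_inner_le s' s)
      (norm_nonneg _) (covTrace_nonneg _)
  · exact (norm_inner_le_norm _ _).trans (mul_le_mul (hX.norm_hsAutoCov_le _)
      (hX.norm_hsAutoCov_le _) (norm_nonneg _) (covTrace_nonneg _))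

/-- Shift invariance moves the last argument to `0`; then `t' - s'` plays the role of the index of
the supremum. -/
theorem sum_norm_cum4_le (hX : IsRegularField e P X) {M : ℝ≥0} (hM : cumulantSum e P X ≤ M)
    (G : Finset (Fin d → ℤ)) (t' s' : Fin d → ℤ) :
    ∑ t ∈ G, ∑ s ∈ G, ‖cum4 e P (X t) (X s) (X t') (X s')‖ ≤ M := by
  have hshift : ∀ t s, cum4 e P (X t) (X s) (X t') (X s')
      = cum4 e P (X (t - s')) (X (s - s')) (X (t' - s')) (X 0) := by
    intro t s
    have := hX.cum_shift (t - s') (s - s') (t' - s') 0 s'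
    simpa using this
  set F : (Fin d → ℤ) → (Fin d → ℤ) → ℝ≥0∞ :=
    fun u v => ‖cum4 e P (X u) (X v) (X (t' - s')) (X 0)‖ₑ with hF
  have h1 : ∑ t ∈ G, ∑ s ∈ G, ‖cum4 e P (X t) (X s) (X t') (X s')‖ₑ ≤ M := by
    simp_rw [hshift]
    calc ∑ t ∈ G, ∑ s ∈ G, F (t - s') (s - s')
        ≤ ∑ t ∈ G, ∑' s, F (t - s') (s - s') :=
          Finset.sum_le_sum fun t _ => ENNReal.sum_le_tsum _
      _ ≤ ∑' t, ∑' s, F (t - s') (s - s') := ENNReal.sum_le_tsum _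
      _ = ∑' t, ∑' s, F (t - s') s :=
          tsum_congr fun t => (Equiv.subRight s').tsum_eq (F (t - s'))
      _ = ∑' t, ∑' s, F t s := (Equiv.subRight s').tsum_eq fun t => ∑' s, F t s
      _ ≤ cumulantSum e P X := le_iSup
          (fun w => ∑' u, ∑' v, ‖cum4 e P (X u) (X v) (X w) (X 0)‖ₑ) (t' - s')
      _ ≤ M := hM
  have h2 := ENNReal.toReal_mono ENNReal.coe_ne_top h1
  rw [ENNReal.toReal_sum (fun t _ => ENNReal.sum_ne_top.2 fun s _ => enorm_ne_top),
    ENNReal.coe_toReal] at h2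
  refine le_trans (le_of_eq (Finset.sum_congr rfl fun t _ => ?_)) h2
  rw [ENNReal.toReal_sum (fun s _ => by finiteness)]
  simp only [toReal_enorm]

/-- With `q` fixed, each product of covariance traces separates into a function of `t` times a
function of `s`, both injective reindexings of a series with sum at most `L`. -/
theorem sum_norm_scalarCov_le [TopologicalSpace.SeparableSpace H] (hX : IsRegularField e P X)
    {M : ℝ≥0} (hM : cumulantSum e P X ≤ M) {L : ℝ} (hL : 0 ≤ L)
    (hs : Summable (covTrace e P X)) (hsL : ∑' k, covTrace e P X k ≤ L)
    (G : Finset (Fin d → ℤ)) (q : (Fin d → ℤ) × (Fin d → ℤ)) :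
    ∑ p ∈ G ×ˢ G, ‖scalarCov P (fun ω => hsRankOne e (X p.1 ω) (X p.2 ω))
      (fun ω => hsRankOne e (X q.1 ω) (X q.2 ω))‖ ≤ M + 2 * L ^ 2 := by
  have hinj : ∀ f : (Fin d → ℤ) → (Fin d → ℤ), Function.Injective f →
      ∑ t ∈ G, covTrace e P X (f t) ≤ L := fun f hf => by
    refine le_trans ?_ hsL
    have := Finset.sum_map G ⟨f, hf⟩ (covTrace e P X)
    simp only [Function.Embedding.coeFn_mk] at this
    rw [← this]
    exact hs.sum_le_tsum _ fun k _ => covTrace_nonneg k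
  have hprod : ∀ f f' : (Fin d → ℤ) → (Fin d → ℤ), Function.Injective f →
      Function.Injective f' →
      ∑ t ∈ G, ∑ s ∈ G, covTrace e P X (f t) * covTrace e P X (f' s) ≤ L ^ 2 :=
    fun f f' hf hf' => by
      rw [← Finset.sum_mul_sum, sq]
      exact mul_le_mul (hinj f hf) (hinj f' hf')
        (Finset.sum_nonneg fun _ _ => covTrace_nonneg _) hL
  obtain ⟨t', s'⟩ := q
  rw [Finset.sum_product]
  calc _ ≤ ∑ t ∈ G, ∑ s ∈ G, (‖cum4 e P (X t) (X s) (X t') (X s')‖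
        + covTrace e P X (t' - t) * covTrace e P X (s - s')
        + covTrace e P X (t - s') * covTrace e P X (t' - s)) :=
        Finset.sum_le_sum fun t _ => Finset.sum_le_sum fun s _ => hX.norm_scalarCov_le t s t' s'
    _ ≤ M + L ^ 2 + L ^ 2 := by
        simp only [Finset.sum_add_distrib]
        exact add_le_add (add_le_add (hX.sum_norm_cum4_le hM G t' s')
          (hprod (fun t => t' - t) (fun s => s - s') sub_right_injective sub_left_injective))
          (hprod (fun t => t - s') (fun s => t' - s) sub_left_injective sub_right_injective)
    _ = _ := by ring

/-! ### The estimator as a random square-summable family -/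

theorem estimator_eq_sum (K : EuclideanSpace ℝ (Fin d) → ℝ) (N : Fin d → ℕ) (Δ : ℝ)
    (X : (Fin d → ℤ) → Ω → H) (θ : Fin d → ℝ) (ω : Ω) :
    estimator K N Δ X θ ω = ∑ p ∈ grid N ×ˢ grid N, lagWeight K N Δ θ (p.1 - p.2) •
      InnerProductSpace.rankOne ℂ (X p.1 ω) (X p.2 ω) := by
  rw [estimator, Finset.sum_product, Finset.smul_sum]
  refine Finset.sum_congr rfl fun t _ => ?_
  rw [Finset.smul_sum]
  refine Finset.sum_congr rfl fun s _ => ?_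
  rw [smul_smul, lagWeight]

theorem representsHS_estimator (K : EuclideanSpace ℝ (Fin d) → ℝ) (N : Fin d → ℕ) (Δ : ℝ)
    (X : (Fin d → ℤ) → Ω → H) (θ : Fin d → ℝ) (ω : Ω) :
    RepresentsHS e (estimator K N Δ X θ ω) (∑ p ∈ grid N ×ˢ grid N,
      lagWeight K N Δ θ (p.1 - p.2) • hsRankOne e (X p.1 ω) (X p.2 ω)) := by
  rw [estimator_eq_sum]
  exact RepresentsHS.sum fun p _ => (representsHS_hsRankOne e _ _).smul _

theorem representsHS_integral_estimator (hX : IsRegularField e P X)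
    (K : EuclideanSpace ℝ (Fin d) → ℝ) (N : Fin d → ℕ) (Δ : ℝ) (θ : Fin d → ℝ) :
    RepresentsHS e (∫ ω, estimator K N Δ X θ ω ∂P) (∑ p ∈ grid N ×ˢ grid N,
      lagWeight K N Δ θ (p.1 - p.2) • hsAutoCov e P X (p.1 - p.2)) := by
  have h1 : ∫ ω, estimator K N Δ X θ ω ∂P = ∑ p ∈ grid N ×ˢ grid N,
      lagWeight K N Δ θ (p.1 - p.2) • autoCov P X (p.1 - p.2) := by
    simp_rw [estimator_eq_sum]
    have hint : ∀ p : (Fin d → ℤ) × (Fin d → ℤ), Integrable (fun ω =>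
        (InnerProductSpace.rankOne ℂ (X p.1 ω) (X p.2 ω) : H →L[ℂ] H)) P := fun p =>
      integrable_rankOne (hX.stationary.memLp_two p.1) (hX.stationary.memLp_two p.2)
    rw [integral_finsetSum]
    swap
    · exact fun p _ => (hint p).smul (lagWeight K N Δ θ (p.1 - p.2))
    refine Finset.sum_congr rfl fun p _ => ?_
    rw [integral_smul, ← hX.covOp_eq, covOp]
  rw [h1]
  exact RepresentsHS.sum fun p _ => (hX.representsHS_hsAutoCov _).smul _

theorem representsHS_spectralDensity (hX : IsRegularField e P X) (θ : Fin d → ℝ)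
    (hs : Summable (covTrace e P X)) :
    RepresentsHS e (spectralDensity P X θ)
      ((((2 * Real.pi) ^ d : ℝ) : ℂ)⁻¹ • ∑' k, character k θ • hsAutoCov e P X k) := by
  refine RepresentsHS.smul (RepresentsHS.tsum ?_ ?_ fun k =>
    (hX.representsHS_hsAutoCov k).smul _) _
  · refine Summable.of_norm ?_
    simpa [norm_smul, norm_character] using hX.summable_norm_autoCov
  · refine Summable.of_norm_bounded hs fun k => ?_
    rw [norm_smul, norm_character, one_mul]
    exact hX.norm_hsAutoCov_le k

end IsRegularField

end Field

section MeanSquare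

/-! ### The mean squared error -/

variable {H : Type*} [NormedAddCommGroup H] [InnerProductSpace ℂ H] [CompleteSpace H]
variable {ι : Type*} {Ω : Type*} [MeasurableSpace Ω] {P : Measure Ω} {d : ℕ}
variable {e : HilbertBasis ι ℂ H} {X : (Fin d → ℤ) → Ω → H}

theorem sum_norm_lagWeight_sq_le (K : EuclideanSpace ℝ (Fin d) → ℝ) (N : Fin d → ℕ) (Δ : ℝ)
    (θ : Fin d → ℝ) :
    ∑ p ∈ grid N ×ˢ grid N, ‖lagWeight K N Δ θ (p.1 - p.2)‖ ^ 2
      ≤ ∑ h ∈ grid N - grid N, K (Δ⁻¹ • latticePt h) ^ 2 / overlap N h := by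
  rw [Finset.sum_product, sum_grid_sub N fun h => ‖lagWeight K N Δ θ h‖ ^ 2]
  refine Finset.sum_le_sum fun h hh => ?_
  have hpos := overlap_pos hh
  calc overlap N h • ‖lagWeight K N Δ θ h‖ ^ 2
      ≤ overlap N h * (K (Δ⁻¹ • latticePt h) / overlap N h) ^ 2 := by
        rw [smul_eq_mul, ← sq_abs (_ / _)]
        gcongr
        exact norm_lagWeight_le N Δ θ h
    _ = _ := by field_simp

/-- The error is a centred sum `A` plus a deterministic bias `D`. The pointwise bound `‖A + D‖² ≤ 2
‖A‖² + 2 b²` accounts for the factors `2`. -/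
theorem lintegral_hsNorm_sq_le [TopologicalSpace.SeparableSpace H] [IsProbabilityMeasure P]
    (hX : IsRegularField e P X) {M : ℝ≥0} (hM : cumulantSum e P X ≤ M) {L : ℝ} (hL : 0 ≤ L)
    (hs : Summable (covTrace e P X)) (hsL : ∑' k, covTrace e P X k ≤ L)
    (K : EuclideanSpace ℝ (Fin d) → ℝ) (N : Fin d → ℕ) (Δ : ℝ) (θ : Fin d → ℝ) {b : ℝ}
    (hb : ‖∑ p ∈ grid N ×ˢ grid N, lagWeight K N Δ θ (p.1 - p.2) • hsAutoCov e P X (p.1 - p.2)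
      - (((2 * Real.pi) ^ d : ℝ) : ℂ)⁻¹ • ∑' k, character k θ • hsAutoCov e P X k‖ ≤ b) :
    ∫⁻ ω, hsNorm e (estimator K N Δ X θ ω - spectralDensity P X θ) ^ 2 ∂P
      ≤ ENNReal.ofReal (2 * ((M + 2 * L ^ 2) *
        ∑ h ∈ grid N - grid N, K (Δ⁻¹ • latticePt h) ^ 2 / overlap N h) + 2 * b ^ 2) := by
  set c : (Fin d → ℤ) × (Fin d → ℤ) → ℂ := fun p => lagWeight K N Δ θ (p.1 - p.2) with hc
  set W : (Fin d → ℤ) × (Fin d → ℤ) → Ω → lp (fun _ : ι => H) 2 :=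
    fun p ω => hsRankOne e (X p.1 ω) (X p.2 ω) with hW
  set D := ∑ p ∈ grid N ×ˢ grid N, c p • hsAutoCov e P X (p.1 - p.2)
      - (((2 * Real.pi) ^ d : ℝ) : ℂ)⁻¹ • ∑' k, character k θ • hsAutoCov e P X k with hD
  set A : Ω → lp (fun _ : ι => H) 2 :=
    fun ω => ∑ p ∈ grid N ×ˢ grid N, c p • (W p ω - ∫ ω', W p ω' ∂P) with hA
  have hWm : ∀ p, MemLp (W p) 2 P := fun p =>
    memLp_hsRankOne e (hX.memLp_four p.1) (hX.memLp_four p.2)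
  have hAm : MemLp A 2 P := by
    refine memLp_finsetSum _ fun p _ => ?_
    exact ((hWm p).sub (memLp_const _)).const_smul (c p)
  have hAint : Integrable (fun ω => ‖A ω‖ ^ 2) P := hAm.integrable_norm_pow two_ne_zero
  have hvar : ∫ ω, ‖A ω‖ ^ 2 ∂P ≤ (M + 2 * L ^ 2) *
      ∑ h ∈ grid N - grid N, K (Δ⁻¹ • latticePt h) ^ 2 / overlap N h := by
    refine (integral_norm_sq_sum_le _ (fun p _ => hWm p) c fun q _ =>
      hX.sum_norm_scalarCov_le hM hL hs hsL (grid N) q).trans ?_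
    gcongr
    exact sum_norm_lagWeight_sq_le K N Δ θ
  have hpt : ∀ ω, hsNorm e (estimator K N Δ X θ ω - spectralDensity P X θ) ^ 2
      ≤ ENNReal.ofReal (2 * ‖A ω‖ ^ 2 + 2 * b ^ 2) := by
    intro ω
    rw [((IsRegularField.representsHS_estimator K N Δ X θ ω).sub
      (hX.representsHS_spectralDensity θ hs)).hsNorm_eq]
    have hsplit : ∑ p ∈ grid N ×ˢ grid N, c p • W p ω
        - (((2 * Real.pi) ^ d : ℝ) : ℂ)⁻¹ • ∑' k, character k θ • hsAutoCov e P X k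
        = A ω + D := by
      simp only [hA, hD, hW, smul_sub, Finset.sum_sub_distrib, hX.integral_hsRankOne_eq]
      abel
    change ‖∑ p ∈ grid N ×ˢ grid N, c p • W p ω - _‖ₑ ^ 2 ≤ _
    rw [hsplit, ← ofReal_norm, ← ENNReal.ofReal_pow (norm_nonneg _)]
    refine ENNReal.ofReal_le_ofReal ?_
    have h1 := norm_add_le (A ω) D
    have h2 : ‖A ω + D‖ ^ 2 ≤ (‖A ω‖ + b) ^ 2 := by
      gcongr
      linarith
    nlinarith [sq_nonneg (‖A ω‖ - b)]
  refine (lintegral_mono hpt).trans ?_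
  have hint : Integrable (fun ω => 2 * ‖A ω‖ ^ 2 + 2 * b ^ 2) P :=
    (hAint.const_mul 2).add (integrable_const _)
  rw [← ofReal_integral_eq_lintegral_ofReal hint
    (Eventually.of_forall fun ω => by positivity)]
  refine ENNReal.ofReal_le_ofReal ?_
  rw [integral_add (hAint.const_mul 2) (integrable_const _), integral_const_mul]
  simp only [integral_const, probReal_univ, one_smul]
  linarith

end MeanSquare

end SpectralDensity

end

/-! ### Assembly of the bias and mean-square rates -/

open SpectralDensity
theorem mainTheorem7
    {d : ℕ} (hd : 1 ≤ d)
    {H : Type*} [NormedAddCommGroup H] [InnerProductSpace ℂ H] [CompleteSpace H]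
    [TopologicalSpace.SeparableSpace H]
    {ι : Type*} (e : HilbertBasis ι ℂ H)
    (K : EuclideanSpace ℝ (Fin d) → ℝ) (hK : IsKernel K)
    (β L : ℝ) (hβ : 0 < β) (hL : 0 < L)
    (r : ℕ) (hr : max 0 (β - 1) < (r : ℝ)) (hKr : IsFlatToOrder K r)
    (N : ℕ → Fin d → ℕ) (hN : ∀ i, Tendsto (fun n => N n i) atTop atTop)
    (Δ : ℕ → ℝ) (hΔ : ∀ n, 0 < Δ n)
    (hsupp : ∀ n, ∀ k : Fin d → ℤ,
      latticePt k ∈ Δ n • kernelSupport K →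
        k ∈ grid (N n) - grid (N n))
    (hrate : Tendsto (fun n => Δ n ^ d / ((grid (N n)).card : ℝ)) atTop (𝓝 0)) :
    -- the bias
    (∃ c : ℝ, ∀ᶠ n in atTop,
      ∀ (Ω : Type*) [MeasurableSpace Ω] (P : Measure Ω) [IsProbabilityMeasure P]
        (X : (Fin d → ℤ) → Ω → H),
        IsRegularField e P X →
        spectralDensity P X ∈ powerLawClass e d β L →
        ∀ θ ∈ Set.Icc (fun _ : Fin d => -Real.pi) (fun _ => Real.pi),
          hsNorm e
              ((∫ ω, estimator K (N n) (Δ n) X θ ω ∂P)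
                - spectralDensity P X θ)
            ≤ ENNReal.ofReal (c * Δ n ^ (-β))) ∧
    -- the root mean squared error
    ((∀ n, Δ n = ((grid (N n)).card : ℝ) ^ (1 / (2 * β + d))) →
      ∀ M : ℝ≥0, ∃ c : ℝ, ∀ᶠ n in atTop,
        ∀ (Ω : Type*) [MeasurableSpace Ω] (P : Measure Ω) [IsProbabilityMeasure P]
          (X : (Fin d → ℤ) → Ω → H),
          IsRegularField e P X →
          cumulantSum e P X ≤ M →
          spectralDensity P X ∈ powerLawClass e d β L →
          ∀ θ ∈ Set.Icc (fun _ : Fin d => -Real.pi) (fun _ => Real.pi),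
            (∫⁻ ω, hsNorm e
                (estimator K (N n) (Δ n) X θ ω
                  - spectralDensity P X θ) ^ 2 ∂P) ^ (1 / 2 : ℝ)
              ≤ ENNReal.ofReal
                  (c * ((grid (N n)).card : ℝ) ^ (-(β / (2 * β + d))))) := by
  obtain ⟨c₁, hc₁, hKβ⟩ := abs_kernel_sub_one_le hK hKr hβ ((le_max_right _ _).trans_lt hr)
  constructor
  · refine ⟨c₁ * L, Eventually.of_forall fun n Ω _ P _ X hX hf θ _ => ?_⟩
    obtain ⟨hg, hgL⟩ := hX.tsum_covTrace_of_mem_powerLawClass hL.le hf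
    rw [((hX.representsHS_integral_estimator K (N n) (Δ n) θ).sub
      (hX.representsHS_spectralDensity θ (IsRegularField.tsum_covTrace_le hg hgL).1)).hsNorm_eq,
      ← ofReal_norm]
    exact ENNReal.ofReal_le_ofReal (norm_lag_series_sub_le hK.nonneg hc₁ hKβ (hΔ n) (hsupp n)
      hX.norm_hsAutoCov_le hg hgL θ)
  · intro hΔeq M
    obtain ⟨C, hC, hvar⟩ := exists_sum_sq_div_overlap_le hd hK hKr
    -- The two summands are the variance and squared-bias constants; for the prescribed bandwidth
    -- both multiply the same power of the sample size.
    set B : ℝ := 2 * ((M + 2 * L ^ 2) * C) + 2 * (c₁ * L) ^ 2 with hB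
    have hB0 : 0 ≤ B := by positivity
    refine ⟨√B, ?_⟩
    have hN1 : ∀ᶠ n in atTop, ∀ l, 1 ≤ N n l :=
      eventually_all.2 fun l => (hN l).eventually_ge_atTop 1
    filter_upwards [hN1] with n hn Ω _ P _ X hX hM hf θ _
    obtain ⟨hg, hgL⟩ := hX.tsum_covTrace_of_mem_powerLawClass hL.le hf
    obtain ⟨hs, hsL⟩ := IsRegularField.tsum_covTrace_le hg hgL
    have hbias := norm_lag_series_sub_le hK.nonneg hc₁ hKβ (hΔ n) (hsupp n)
      hX.norm_hsAutoCov_le hg hgL θ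
    have hmse := lintegral_hsNorm_sq_le hX hM hL.le hs hsL K (N n) (Δ n) θ hbias
    set T : ℝ := ((grid (N n)).card : ℝ) with hT
    have hT1 : 1 ≤ T := by
      rw [hT, card_grid]
      exact_mod_cast Finset.one_le_prod' fun l _ => hn l
    have hT0 : 0 < T := by linarith
    have hq : 0 < 2 * β + d := by positivity
    -- The weight bound requires `Δ ≥ 1`, which follows from the prescribed bandwidth once the grid
    -- is nonempty.
    have hΔ1 : 1 ≤ Δ n := by
      rw [hΔeq n]
      exact Real.one_le_rpow hT1 (by positivity)
    -- The bandwidth balances the two errors: `Δ ^ d / T = Δ ^ (-2β)`.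
    have hpow : Δ n ^ d / T = (T ^ (-(β / (2 * β + d)))) ^ 2 := by
      rw [hΔeq n, ← Real.rpow_mul_natCast hT0.le, ← Real.rpow_mul_natCast hT0.le,
        ← Real.rpow_sub_one hT0.ne']
      congr 1
      field_simp
      push_cast
      ring
    have hpow' : Δ n ^ (-β) = T ^ (-(β / (2 * β + d))) := by
      rw [hΔeq n, ← Real.rpow_mul hT0.le]
      congr 1
      ring
    have hS := hvar (N n) (Δ n) hΔ1 hn (hsupp n)
    rw [hpow] at hS
    rw [hpow'] at hmse
    have hfinal : ∫⁻ ω, hsNorm e (estimator K (N n) (Δ n) X θ ω - spectralDensity P X θ) ^ 2 ∂P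
        ≤ ENNReal.ofReal (√B * T ^ (-(β / (2 * β + d)))) ^ (2 : ℝ) := by
      refine hmse.trans ?_
      rw [ENNReal.rpow_ofNat, ← ENNReal.ofReal_pow (by positivity)]
      refine ENNReal.ofReal_le_ofReal ?_
      rw [mul_pow √B, Real.sq_sqrt hB0, hB, mul_pow]
      have hΛ : 0 ≤ (M : ℝ) + 2 * L ^ 2 := by positivity
      nlinarith [mul_le_mul_of_nonneg_left hS hΛ]
    calc _ ≤ (ENNReal.ofReal (√B * T ^ (-(β / (2 * β + d)))) ^ (2 : ℝ)) ^ (1 / 2 : ℝ) := by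
          gcongr
      _ = _ := by
          rw [← ENNReal.rpow_mul]
          norm_num
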